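/- Let $\mathcal{C}at$ be the category of small categories and functors, and let $s\mathcal{S}$ be the category of simplicial spaces, i.e. simplicial objects $[m]\mapsto X_m$ in the category $\mathcal{S}$ of simplicial sets; $s\mathcal{S}$ is cartesian closed, with internal hom $Y^X$. For a small category $C$ let $C^{[m]}$ be the category of functors $[m]=\{0\to 1\to\dots\to m\}\to C$, and let $\operatorname{iso}(C^{[m]})$ be its maximal subgroupoid. The classifying diagram of $C$ is the simplicial space $NC$ with $$(NC)_m=\operatorname{nerve}\,\operatorname{iso}(C^{[m]}),$$ and this defines a functor $N\colon\mathcal{C}at\to s\mathcal{S}$. A map of simplicial spaces is a weak equivalence (in the Reedy model structure) if it is a weak equivalence of simplicial sets in each degree $m\ge 0$. **Theorem.** (1) For small categories $C$ and $D$ there are isomorphisms of simplicial spaces, natural in $C$ and $D$, $$N(C\times D)\cong NC\times ND\qquad\text{and}\qquad N(D^C)\cong (ND)^{NC},$$ the first being the map whose components are induced by the two projections, and the second being the map adjoint to $NC\times N(D^C)\cong N(C\times D^C)\to ND$, where the last map is induced by the evaluation functor $C\times D^C\to D$. (2) The functor $N\colon\mathcal{C}at\to s\mathcal{S}$ is a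 full embedding, i.e. it is full and faithful. (3) A functor $f\colon C\to D$ between small categories is an equivalence of categories if and only if $Nf\colon NC\to ND$ is a weak equivalence of simplicial spaces. -/

import Mathlib

open CategoryTheory MonoidalCategory CartesianMonoidalCategory Opposite

universe u

/-- A map `f : X ⟶ Y` of simplicial sets is a weak (homotopy) equivalence if for every Kan complex
`K` restriction along `f` induces a bijection `π₀ Map(Y, K) → π₀ Map(X, K)`, where `Map(X, K)` is
the simplicial set whose `n`-simplices are the maps `X × Δ[n] ⟶ K`. -/
def SSet.IsWeakEquivalence {X Y : SSet.{u}} (f : X ⟶ Y) : Prop :=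
  ∀ (K : SSet.{u}) [SSet.KanComplex K],
    Function.Bijective (SSet.mapπ₀ ((MonoidalClosed.pre f).app K))

/-- Simplicial spaces, i.e. simplicial objects in simplicial sets: `X.obj (op ⦋m⦌)` is the `m`-th
space of `X`. -/
abbrev SimplicialSpace : Type (u + 1) := SimplicialObject SSet.{u}

namespace SimplicialSpace

/-- The category of simplicial spaces is cartesian closed. The internal hom `Y ^ X` is
`(ihom X).obj Y`. -/
noncomputable instance : MonoidalClosed SimplicialSpace.{u} :=
  MonoidalClosed.FunctorCategory.monoidalClosed

/-- A weak equivalence of simplicial spaces in the Reedy model structure: a map which is a weak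
equivalence of simplicial sets in every degree. -/
def IsWeakEquivalence {X Y : SimplicialSpace.{u}} (f : X ⟶ Y) : Prop :=
  ∀ m : ℕ, SSet.IsWeakEquivalence (f.app (op (SimplexCategory.mk m)))

end SimplicialSpace

/-- The classifying diagram `N C` of a small category `C`. Its `m`-th space is the nerve of the
maximal subgroupoid of the category of functors `[m] ⥤ C`; simplicial operators act by
precomposition, and functors `C ⥤ D` act by postcomposition. -/
def classifyingDiagram : Cat.{u, u} ⥤ SimplicialSpace.{u} where
  obj C :=
    { obj := fun m => nerve (Core (Fin (m.unop.len + 1) ⥤ C))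
      map := fun f => nerveMap (((Functor.whiskeringLeft _ _ C).obj
        (SimplexCategory.toCat.map f.unop).toFunctor).core)
      map_id := fun _ => rfl
      map_comp := fun _ _ => rfl }
  map F :=
    { app := fun m => nerveMap (((Functor.whiskeringRight (Fin (m.unop.len + 1)) _ _).obj
        F.toFunctor).core)
      naturality := fun _ _ _ => rfl }
  map_id _ := rfl
  map_comp _ _ := rfl

/-! A simplex of `N C` is a grid of commuting squares in `C` whose horizontal arrows are arbitrary
and whose vertical arrows are invertible. It is determined by these arrows, and so a map `Z ⟶ N D`
is determined by its values on horizontal and vertical edges (`hom_ext`). Conversely, values on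
vertices and edges that respect identities, compositions and squares, collected in a `GridFunctor`,
extend to a map (`GridFunctor.toHom`).

Currying is therefore done on grid functors: for a map `N C ⊗ X ⟶ N D`, a vertex of `X` gives a
functor `C ⥤ D`, a horizontal edge a natural transformation, a vertical edge a natural isomorphism.
`exists_curry` and `curry_injective` then say that the evaluation `N C ⊗ N (C ⥤ D) ⟶ N D` is
universal, which identifies the exponential. Fullness is the case where `X` is terminal, since a
vertex of `N (C ⥤ D)` is a functor.

For weak equivalences, natural transformations become homotopies of nerves, and an equivalence `C ⥤
D` induces equivalences of the groupoids in every degree. Conversely, nerves of groupoids are Kan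
complexes, so they may serve as test objects, and a Yoneda argument turns a weak equivalence between
them into an equivalence of groupoids. Degrees 0 and 1 then suffice (`isEquivalence_of_core`):
degree 0 controls objects and isomorphisms, degree 1 controls arrows. -/

section

open Simplicial

/-! ### Vertices and edges of mapping spaces; homotopy invariance of restriction. -/

namespace SSet
variable {X Y Z K : SSet.{u}}

/-- The `n`-simplices of the mapping space `Map(X, K)` are the maps `X × Δ[n] ⟶ K`. -/
noncomputable def ihomSimplexEquiv (X K : SSet.{u}) (n : ℕ) :
    (X ⊗ Δ[n] ⟶ K) ≃ ((ihom X).obj K) _⦋n⦌ :=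
  ((ihom.adjunction X).homEquiv _ _).trans yonedaEquiv

lemma ihomSimplexEquiv_pre (f : X ⟶ Y) {n : ℕ} (u : Y ⊗ Δ[n] ⟶ K) :
    ((MonoidalClosed.pre f).app K).app _ (ihomSimplexEquiv Y K n u) =
      ihomSimplexEquiv X K n (f ▷ _ ≫ u) := by
  have h := MonoidalClosed.curry_pre_app f u
  have := yonedaEquiv_comp (MonoidalClosed.curry u) ((MonoidalClosed.pre f).app K)
  rw [h] at this
  exact this.symm

lemma ihomSimplexEquiv_δ {n : ℕ} (i : Fin (n + 2)) (u : X ⊗ Δ[n + 1] ⟶ K) :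
    ((ihom X).obj K).δ i (ihomSimplexEquiv X K (n + 1) u) =
      ihomSimplexEquiv X K n (X ◁ stdSimplex.δ i ≫ u) := by
  have h := MonoidalClosed.curry_natural_left (A := X) (SSet.stdSimplex.δ i) u
  have h' := SSet.yonedaEquiv_symm_naturality_left (SimplexCategory.δ i)
    (SSet.yonedaEquiv (MonoidalClosed.curry u))
  rw [Equiv.symm_apply_apply, Equiv.eq_symm_apply] at h'
  change _ = SSet.yonedaEquiv (MonoidalClosed.curry _)
  rw [h]
  exact h'.symm

/-- A map `X ⟶ K` viewed as a vertex of the mapping space. -/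
noncomputable def homVertex (f : X ⟶ K) : ((ihom X).obj K) _⦋0⦌ :=
  ihomSimplexEquiv X K 0 (fst _ _ ≫ f)

lemma homVertex_surjective : Function.Surjective (homVertex (X := X) (K := K)) := by
  intro x
  obtain ⟨w, rfl⟩ := (ihomSimplexEquiv X K 0).surjective x
  -- As `Δ[0]` is terminal, this section of the projection `X ⊗ Δ[0] ⟶ X` is its inverse.
  refine ⟨lift (𝟙 X) (stdSimplex.isTerminalObj₀.from X) ≫ w, ?_⟩
  unfold homVertex
  congr 1
  rw [← Category.assoc]
  convert Category.id_comp w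
  apply CartesianMonoidalCategory.hom_ext
  · simp
  · exact stdSimplex.isTerminalObj₀.hom_ext _ _

lemma homVertex_injective : Function.Injective (homVertex (X := X) (K := K)) := by
  intro f g h
  have h' := (ihomSimplexEquiv X K 0).injective h
  have := lift (𝟙 X) (stdSimplex.isTerminalObj₀.from X) ≫= h'
  simpa using this

lemma whiskerLeft_δ_one : X ◁ stdSimplex.δ (1 : Fin 2) = fst X _ ≫ ι₀ := by
  rw [stdSimplex.δ_one_eq_const]
  rfl

lemma whiskerLeft_δ_zero : X ◁ stdSimplex.δ (0 : Fin 2) = fst X _ ≫ ι₁ := by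
  rw [stdSimplex.δ_zero_eq_const]
  rfl

/-- A homotopy gives an edge of the mapping space. -/
noncomputable def homEdge (h : X ⊗ Δ[1] ⟶ K) :
    Edge (homVertex (ι₀ ≫ h)) (homVertex (ι₁ ≫ h)) :=
  Edge.mk (ihomSimplexEquiv X K 1 h)
    (by rw [ihomSimplexEquiv_δ, whiskerLeft_δ_one, Category.assoc]; rfl)
    (by rw [ihomSimplexEquiv_δ, whiskerLeft_δ_zero, Category.assoc]; rfl)

lemma exists_homotopy_of_edge {f g : X ⟶ K} (e : Edge (homVertex f) (homVertex g)) :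
    ∃ h : X ⊗ Δ[1] ⟶ K, ι₀ ≫ h = f ∧ ι₁ ≫ h = g := by
  obtain ⟨h, hh⟩ := (ihomSimplexEquiv X K 1).surjective e.edge
  refine ⟨h, homVertex_injective ?_, homVertex_injective ?_⟩
  · rw [← e.src_eq, ← hh]
    exact (homEdge h).src_eq.symm
  · rw [← e.tgt_eq, ← hh]
    exact (homEdge h).tgt_eq.symm

lemma mapπ₀_pre_homVertex (f : X ⟶ Y) (u : Y ⟶ K) :
    mapπ₀ ((MonoidalClosed.pre f).app K) (π₀.mk (homVertex u)) = π₀.mk (homVertex (f ≫ u)) := by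
  rw [mapπ₀_mk, homVertex, ihomSimplexEquiv_pre]
  rfl

/-- Composing the homotopy with `u : Y ⟶ K` gives an edge of the mapping space joining the two
restrictions of `u`. -/
lemma mapπ₀_pre_eq_of_homotopy (h : X ⊗ Δ[1] ⟶ Y) :
    mapπ₀ ((MonoidalClosed.pre (ι₀ ≫ h)).app K) = mapπ₀ ((MonoidalClosed.pre (ι₁ ≫ h)).app K) := by
  funext x
  obtain ⟨x, rfl⟩ := π₀.mk_surjective x
  obtain ⟨u, rfl⟩ := homVertex_surjective x
  rw [mapπ₀_pre_homVertex, mapπ₀_pre_homVertex, Category.assoc, Category.assoc]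
  exact π₀.sound (homEdge (h ≫ u))

lemma mapπ₀_pre_comp (f : X ⟶ Y) (g : Y ⟶ Z) (x) :
    mapπ₀ ((MonoidalClosed.pre (f ≫ g)).app K) x =
      mapπ₀ ((MonoidalClosed.pre f).app K) (mapπ₀ ((MonoidalClosed.pre g).app K) x) := by
  obtain ⟨x, rfl⟩ := π₀.mk_surjective x
  obtain ⟨u, rfl⟩ := homVertex_surjective x
  simp only [mapπ₀_pre_homVertex, Category.assoc]

lemma mapπ₀_pre_id (x) :
    mapπ₀ ((MonoidalClosed.pre (𝟙 X)).app K) x = x := by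
  obtain ⟨x, rfl⟩ := π₀.mk_surjective x
  obtain ⟨u, rfl⟩ := homVertex_surjective x
  simp only [mapπ₀_pre_homVertex, Category.id_comp]

end SSet

/-! ### Natural transformations as homotopies of nerves. -/

namespace CategoryTheory

section

variable {C D : Type u} [Category.{u} C] [Category.{u} D]

/-- A natural transformation induces a homotopy between maps of nerves. -/
def nerveHomotopy {F G : C ⥤ D} (α : F ⟶ G) : nerve C ⊗ Δ[1] ⟶ nerve D where
  -- A simplex is a chain in `C` with a monotone map to `[1]`; the pair is composed with the functor
  -- `C × [1] ⥤ D` that encodes `α`.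
  app m := ↾fun x => (Functor.prod' x.1 (SSet.stdSimplex.asOrderHom x.2).monotone.functor) ⋙
    Functor.uncurry.obj (Functor.flip (ComposableArrows.mk₁ α))

lemma ι₀_nerveHomotopy {F G : C ⥤ D} (α : F ⟶ G) : SSet.ι₀ ≫ nerveHomotopy α = nerveMap F := by
  ext m x
  refine Arrow.functor_ext fun i j f => ?_
  change Arrow.mk (F.map (x.map f) ≫ 𝟙 _) = Arrow.mk (F.map (x.map f))
  rw [Category.comp_id]

lemma ι₁_nerveHomotopy {F G : C ⥤ D} (α : F ⟶ G) : SSet.ι₁ ≫ nerveHomotopy α = nerveMap G := by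
  ext m x
  refine Arrow.functor_ext fun i j f => ?_
  change Arrow.mk (G.map (x.map f) ≫ 𝟙 _) = Arrow.mk (G.map (x.map f))
  rw [Category.comp_id]

/-- The unit and counit are homotopies, so restriction along the nerve of the inverse functor is a
two-sided inverse on `π₀`. -/
lemma isWeakEquivalence_nerveMap (F : C ⥤ D) [F.IsEquivalence] :
    SSet.IsWeakEquivalence (nerveMap F) := by
  intro K _
  let e := F.asEquivalence
  have h₁ (x) : SSet.mapπ₀ ((MonoidalClosed.pre (nerveMap F ≫ nerveMap e.inverse)).app K) x = x := by
    have := SSet.mapπ₀_pre_eq_of_homotopy (K := K) (nerveHomotopy e.unit)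
    rw [ι₀_nerveHomotopy, ι₁_nerveHomotopy] at this
    exact (congr_fun this.symm x).trans (SSet.mapπ₀_pre_id x)
  have h₂ (x) : SSet.mapπ₀ ((MonoidalClosed.pre (nerveMap e.inverse ≫ nerveMap F)).app K) x = x := by
    have := SSet.mapπ₀_pre_eq_of_homotopy (K := K) (nerveHomotopy e.counit)
    rw [ι₀_nerveHomotopy, ι₁_nerveHomotopy] at this
    exact (congr_fun this x).trans (SSet.mapπ₀_pre_id x)
  simp only [SSet.mapπ₀_pre_comp] at h₁ h₂
  exact Function.bijective_iff_has_inverse.mpr ⟨_, h₂, h₁⟩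

end

end CategoryTheory

/-! ### From weak equivalences of nerves back to equivalences. -/

namespace CategoryTheory

section

variable {C D : Type u} [Category.{u} C] [Category.{u} D]

lemma exists_nerveMap_eq (u : nerve C ⟶ nerve D) : ∃ F : C ⥤ D, nerveMap F = u :=
  ⟨(nerveFunctor.fullyfaithful.preimage (X := Cat.of C) (Y := Cat.of D) u).toFunctor,
    nerveFunctor.fullyfaithful.map_preimage (X := Cat.of C) (Y := Cat.of D) u⟩

lemma nerveMap_injective : Function.Injective (nerveMap (C := C) (D := D)) := fun F G h => by
  have := nerveFunctor.fullyfaithful.map_injective (X := Cat.of C) (Y := Cat.of D)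
    (f := F.toCatHom) (g := G.toCatHom) h
  exact congr_arg Cat.Hom.toFunctor this

/-- A homotopy between the nerves of two functors comes from a natural transformation. -/
lemma nonempty_hom_of_homotopy {F G : C ⥤ D} (h : nerve C ⊗ Δ[1] ⟶ nerve D)
    (h₀ : SSet.ι₀ ≫ h = nerveMap F) (h₁ : SSet.ι₁ ≫ h = nerveMap G) : Nonempty (F ⟶ G) := by
  -- The canonical comparison from the nerve of `C × [1]`. Since the nerve is full, `c ≫ h` is
  -- induced by a functor `K` on `C × [1]`, and the required transformation is `K` applied to the
  -- arrow `0 ⟶ 1`.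
  let c : nerve (C × ULift.{u} (Fin 2)) ⟶ nerve C ⊗ Δ[1] :=
    lift (nerveMap (CategoryTheory.Prod.fst _ _))
      (nerveMap (CategoryTheory.Prod.snd _ _) ≫ (SSet.stdSimplex.isoNerve 1).inv)
  obtain ⟨K, hK⟩ := exists_nerveMap_eq (c ≫ h)
  let i (t : Fin 2) : C ⥤ C × ULift.{u} (Fin 2) := (𝟭 C).prod' ((Functor.const C).obj ⟨t⟩)
  have hF : i 0 ⋙ K = F := nerveMap_injective (by
    rw [← h₀]
    change nerveMap (i 0) ≫ nerveMap K = _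
    rw [hK]
    rfl)
  have hG : i 1 ⋙ K = G := nerveMap_injective (by
    rw [← h₁]
    change nerveMap (i 1) ≫ nerveMap K = _
    rw [hK]
    rfl)
  subst hF hG
  let α : i 0 ⟶ i 1 :=
    { app := fun c => (𝟙 c, homOfLE (show (⟨0⟩ : ULift.{u} (Fin 2)) ≤ ⟨1⟩ from Fin.zero_le 1))
      naturality := fun c c' f => by
        ext
        · exact (Category.comp_id f).trans (Category.id_comp f).symm
        · rfl }
  exact ⟨Functor.whiskerRight α K⟩

/-- Equality in `π₀` is a zigzag of edges. Each edge is a natural transformation, invertible because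
`D` is a groupoid, and each intermediate vertex is the nerve of a functor. -/
lemma nonempty_iso_of_π₀_eq {C D : Type u} [Category.{u} C] [Groupoid.{u} D] {F G : C ⥤ D}
    (h : SSet.π₀.mk (SSet.homVertex (nerveMap F)) = SSet.π₀.mk (SSet.homVertex (nerveMap G))) :
    Nonempty (F ≅ G) := by
  rw [SSet.π₀.mk_eq_mk_iff] at h
  generalize hx : SSet.homVertex (nerveMap F) = x at h
  generalize hy : SSet.homVertex (nerveMap G) = y at h
  induction h generalizing F G with
  | rel x y h =>
    subst hx hy
    obtain ⟨e⟩ := h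
    obtain ⟨h, h₀, h₁⟩ := SSet.exists_homotopy_of_edge e
    obtain ⟨α⟩ := nonempty_hom_of_homotopy h h₀ h₁
    have : IsIso α := NatIso.isIso_of_isIso_app α
    exact ⟨asIso α⟩
  | refl x =>
    subst hx
    obtain rfl := nerveMap_injective (SSet.homVertex_injective hy)
    exact ⟨Iso.refl _⟩
  | symm x y h ih =>
    obtain ⟨e⟩ := ih hy hx
    exact ⟨e.symm⟩
  | trans x y z _ _ h₁ h₂ =>
    obtain ⟨u, hu⟩ := SSet.homVertex_surjective y
    obtain ⟨H, rfl⟩ := exists_nerveMap_eq u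
    obtain ⟨e⟩ := h₁ hx hu
    obtain ⟨e'⟩ := h₂ hu hy
    exact ⟨e ≪≫ e'⟩

/-- Surjectivity of restriction into `nerve C` produces `R` with `F ⋙ R ≅ 𝟭 C`. Injectivity of
restriction into `nerve D` gives `R ⋙ F ≅ 𝟭 D`, because the two agree up to isomorphism after
precomposition with `F`. -/
lemma isEquivalence_of_isWeakEquivalence_nerveMap {C D : Type u} [Groupoid.{u} C] [Groupoid.{u} D]
    [SSet.KanComplex (nerve C)] [SSet.KanComplex (nerve D)]
    (F : C ⥤ D) (hF : SSet.IsWeakEquivalence (nerveMap F)) : F.IsEquivalence := by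
  obtain ⟨x, hx⟩ := (hF (nerve C)).2 (SSet.π₀.mk (SSet.homVertex (𝟙 _)))
  obtain ⟨x, rfl⟩ := SSet.π₀.mk_surjective x
  obtain ⟨r, rfl⟩ := SSet.homVertex_surjective x
  obtain ⟨R, rfl⟩ := exists_nerveMap_eq r
  rw [SSet.mapπ₀_pre_homVertex] at hx
  obtain ⟨e⟩ := nonempty_iso_of_π₀_eq (F := F ⋙ R) (G := 𝟭 C) hx
  have h : SSet.π₀.mk (SSet.homVertex (nerveMap (R ⋙ F))) =
      SSet.π₀.mk (SSet.homVertex (nerveMap (𝟭 D))) := by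
    apply (hF (nerve D)).1
    rw [SSet.mapπ₀_pre_homVertex, SSet.mapπ₀_pre_homVertex]
    have := SSet.π₀.sound (SSet.homEdge (nerveHomotopy (Functor.whiskerRight e.hom F)))
    rw [ι₀_nerveHomotopy, ι₁_nerveHomotopy] at this
    exact this
  obtain ⟨e'⟩ := nonempty_iso_of_π₀_eq h
  exact (Equivalence.mk F R e.symm e').isEquivalence_functor

/-- A functor is an equivalence as soon as it induces equivalences on the cores of the categories
of objects and of arrows. -/
lemma isEquivalence_of_core (F : C ⥤ D)
    (h₀ : (((Functor.whiskeringRight (Fin 1) _ _).obj F).core).IsEquivalence)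
    (h₁ : (((Functor.whiskeringRight (Fin 2) _ _).obj F).core).IsEquivalence) :
    F.IsEquivalence := by
  have lift₀ (x y : C) (e : F.obj x ≅ F.obj y) : ∃ e' : x ≅ y, F.mapIso e' = e := by
    let X : Core (Fin 1 ⥤ C) := ⟨ComposableArrows.mk₀ x⟩
    let Y : Core (Fin 1 ⥤ C) := ⟨ComposableArrows.mk₀ y⟩
    let a : ((Functor.whiskeringRight (Fin 1) _ _).obj F).core.obj X ⟶
      ((Functor.whiskeringRight (Fin 1) _ _).obj F).core.obj Y :=
        ⟨NatIso.ofComponents (fun _ => e) (fun {i j} f => by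
          obtain rfl := Subsingleton.elim i j
          obtain rfl := Subsingleton.elim f (𝟙 _)
          simp)⟩
    refine ⟨(Functor.preimage _ a).iso.app 0, ?_⟩
    have := congr_arg (fun t => t.iso.app 0) (Functor.map_preimage _ a)
    exact this
  have inj₀ (x y : C) (e e' : x ≅ y) (h : F.mapIso e = F.mapIso e') : e = e' := by
    let X : Core (Fin 1 ⥤ C) := ⟨ComposableArrows.mk₀ x⟩
    let Y : Core (Fin 1 ⥤ C) := ⟨ComposableArrows.mk₀ y⟩
    let a (e : x ≅ y) : X ⟶ Y := ⟨NatIso.ofComponents (fun _ => e) (fun {i j} f => by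
          obtain rfl := Subsingleton.elim i j
          obtain rfl := Subsingleton.elim f (𝟙 _)
          simp)⟩
    have : a e = a e' := by
      apply ((Functor.whiskeringRight (Fin 1) _ _).obj F).core.map_injective
      ext
      exact congr_arg Iso.hom h
    exact congr_arg (fun t => t.iso.app 0) this
  have ess : F.EssSurj := ⟨fun d => by
    let Y : Core (Fin 1 ⥤ D) := ⟨ComposableArrows.mk₀ d⟩
    let X := ((Functor.whiskeringRight (Fin 1) _ _).obj F).core.objPreimage Y
    exact ⟨X.of.obj 0, ⟨(((Functor.whiskeringRight (Fin 1) _ _).obj F).core.objObjPreimageIso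
      Y).hom.iso.app 0⟩⟩⟩
  have full : F.Full := ⟨fun {x y} g => by
    let Y : Core (Fin 2 ⥤ D) := ⟨ComposableArrows.mk₁ g⟩
    let X := ((Functor.whiskeringRight (Fin 2) _ _).obj F).core.objPreimage Y
    let e := (((Functor.whiskeringRight (Fin 2) _ _).obj F).core.objObjPreimageIso Y).hom.iso
    let a₀ : F.obj (X.of.obj 0) ≅ F.obj x := e.app 0
    let a₁ : F.obj (X.of.obj 1) ≅ F.obj y := e.app 1
    -- `g` is isomorphic to the image of an arrow of `C`; lifting the isomorphisms at the two ends
    -- and conjugating gives a preimage of `g` itself.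
    obtain ⟨e₀, h₀⟩ := lift₀ (X.of.obj 0) x a₀
    obtain ⟨e₁, h₁⟩ := lift₀ (X.of.obj 1) y a₁
    refine ⟨e₀.inv ≫ X.of.map (homOfLE (by decide)) ≫ e₁.hom, ?_⟩
    have h₀' := congr_arg Iso.inv h₀
    have h₁' := congr_arg Iso.hom h₁
    have := e.hom.naturality (homOfLE (show (0 : Fin 2) ≤ 1 by decide))
    simp only [Functor.mapIso_inv, Functor.mapIso_hom] at h₀' h₁'
    rw [F.map_comp, F.map_comp, h₀', h₁']
    exact (Iso.inv_comp_eq a₀).2 this⟩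
  have faith : F.Faithful := ⟨fun {x y} g g' h => by
    let X : Core (Fin 2 ⥤ C) := ⟨ComposableArrows.mk₁ g⟩
    let Y : Core (Fin 2 ⥤ C) := ⟨ComposableArrows.mk₁ g'⟩
    -- The identity square from `F.map g` to `F.map g'` lifts to a square in `C`, whose vertical
    -- sides are identities by `inj₀`; hence `g = g'`.
    let a : ((Functor.whiskeringRight (Fin 2) _ _).obj F).core.obj X ⟶
      ((Functor.whiskeringRight (Fin 2) _ _).obj F).core.obj Y :=
        ⟨ComposableArrows.isoMk₁ (Iso.refl _) (Iso.refl _) (by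
          exact (Category.comp_id (F.map g)).trans (h.trans (Category.id_comp _).symm))⟩
    let b := (Functor.preimage _ a).iso
    have hb := Functor.map_preimage _ a
    have b₀ : b.app 0 = Iso.refl x := inj₀ _ _ _ _ (by
      have := congr_arg (fun t => t.iso.app 0) hb
      refine this.trans ?_
      ext
      exact (F.map_id _).symm)
    have b₁ : b.app 1 = Iso.refl y := inj₀ _ _ _ _ (by
      have := congr_arg (fun t => t.iso.app 1) hb
      refine this.trans ?_
      ext
      exact (F.map_id _).symm)
    have := b.hom.naturality (homOfLE (show (0 : Fin 2) ≤ 1 by decide))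
    have b₀' : b.hom.app 0 = 𝟙 x := congr_arg Iso.hom b₀
    have b₁' : b.hom.app 1 = 𝟙 y := congr_arg Iso.hom b₁
    rw [b₀', b₁'] at this
    exact (Category.comp_id _).symm.trans (this.trans (Category.id_comp _))⟩
  exact { }

end

end CategoryTheory

/-! ### Nerves of groupoids are Kan complexes. -/

namespace CategoryTheory

/-- Equalities are stated between `Arrow`s here and below, since the endpoints often agree only
propositionally. -/
lemma nerve.arrow_mk_homEquiv {C : Type u} [Category.{u} C] {x y : ComposableArrows C 0}
    (e : (nerve C).Edge x y) :
    Arrow.mk (nerve.homEquiv e) = Arrow.mk (ComposableArrows.hom (n := 1) e.edge) :=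
  ComposableArrows.arrowEquiv.symm.injective (nerve.mk₁_homEquiv_apply e)

namespace groupoidHorn

variable {n : ℕ} {i : Fin (n + 3)}

variable (i) in
/-- The vertex `j` of the horn. -/
def vertex (j : Fin (n + 3)) : (Λ[n + 2, i] : SSet.{u}) _⦋0⦌ :=
  ⟨SSet.stdSimplex.obj₀Equiv.symm j, by simp⟩

/-- The edge of the horn between two vertices of a face. -/
def edge (a b : Fin (n + 3)) (hab : a ≤ b) (h : ∃ k, k ≠ i ∧ k ≠ a ∧ k ≠ b) :
    (Λ[n + 2, i] : SSet.{u}).Edge (vertex i a) (vertex i b) :=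
  SSet.Edge.mk ⟨SSet.stdSimplex.edge _ a b hab, by
      rw [SSet.mem_horn_iff_notMem_range]
      obtain ⟨k, hi, ha, hb⟩ := h
      refine ⟨k, hi, ?_⟩
      rintro ⟨x, hx⟩
      fin_cases x
      · exact ha hx.symm
      · exact hb hx.symm⟩
    (by
      apply Subtype.ext
      apply SSet.stdSimplex.obj₀Equiv.injective
      rfl)
    (by
      apply Subtype.ext
      apply SSet.stdSimplex.obj₀Equiv.injective
      rfl)

/-- The triangle of the horn between three vertices of a face. -/
def triangle (a b c : Fin (n + 3)) (hab : a ≤ b) (hbc : b ≤ c)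
    (h : ∃ k, k ≠ i ∧ k ≠ a ∧ k ≠ b ∧ k ≠ c) :
    SSet.Edge.CompStruct (edge.{u} (i := i) a b hab (h.imp fun _ hk => ⟨hk.1, hk.2.1, hk.2.2.1⟩))
      (edge b c hbc (h.imp fun _ hk => ⟨hk.1, hk.2.2.1, hk.2.2.2⟩))
      (edge a c (hab.trans hbc) (h.imp fun _ hk => ⟨hk.1, hk.2.1, hk.2.2.2⟩)) :=
  SSet.Edge.CompStruct.mk ⟨SSet.stdSimplex.triangle a b c hab hbc, by
      rw [SSet.mem_horn_iff_notMem_range]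
      obtain ⟨k, hi, ha, hb, hc⟩ := h
      refine ⟨k, hi, ?_⟩
      rintro ⟨x, hx⟩
      fin_cases x
      · exact ha hx.symm
      · exact hb hx.symm
      · exact hc hx.symm⟩
    (by
      apply Subtype.ext
      ext x
      fin_cases x <;> rfl)
    (by
      apply Subtype.ext
      ext x
      fin_cases x <;> rfl)
    (by
      apply Subtype.ext
      ext x
      fin_cases x <;> rfl)

variable {G : Type u} [Groupoid.{u} G] (g : (Λ[n + 2, i] : SSet.{u}) ⟶ nerve G)

/-- The object at the vertex `j` of a horn in the nerve of a groupoid. -/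
def obj (j : Fin (n + 3)) : G := nerveEquiv (g.app _ (vertex i j))

/-- The morphism at an edge of a horn in the nerve of a groupoid. -/
def map (a b : Fin (n + 3)) (hab : a ≤ b) (h : ∃ k, k ≠ i ∧ k ≠ a ∧ k ≠ b) :
    obj g a ⟶ obj g b :=
  nerve.homEquiv ((edge a b hab h).map g)

lemma map_comp (a b c : Fin (n + 3)) (hab : a ≤ b) (hbc : b ≤ c)
    (h : ∃ k, k ≠ i ∧ k ≠ a ∧ k ≠ b ∧ k ≠ c) (h₁) (h₂) (h₃) :
    map g a b hab h₁ ≫ map g b c hbc h₂ = map g a c (hab.trans hbc) h₃ :=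
  nerve.homEquiv_comp ((triangle a b c hab hbc h).map g)

/-- With at least three vertices, every edge through `i` misses a vertex other than `i`, so it lies
in the horn. -/
lemma exists_ne (i j : Fin (n + 3)) : ∃ k, k ≠ i ∧ k ≠ j := by
  by_contra! h
  have h0 := h 0
  have h1 := h 1
  have h2 := h 2
  have e1 : ((1 : Fin (n + 3)) : ℕ) = 1 := rfl
  have e2 : ((2 : Fin (n + 3)) : ℕ) = 2 := rfl
  simp only [ne_eq, Fin.ext_iff, Fin.val_zero, e1, e2] at h0 h1 h2
  omega

open Classical in
/-- The canonical morphism from the object at the horn vertex. -/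
noncomputable def fromVertex (j : Fin (n + 3)) : obj g i ⟶ obj g j :=
  if h : i ≤ j then map g i j h ((exists_ne i j).imp fun _ h => ⟨h.1, h⟩)
  else Groupoid.inv (map g j i (le_of_not_ge h) ((exists_ne i j).imp fun _ h => ⟨h.1, h.2, h.1⟩))

/-- Wherever `i` stands relative to `a ≤ b`, the triangle on these three vertices lies in the face
opposite `k`, hence in the horn, and gives the relation. -/
lemma fromVertex_comp_map (a b : Fin (n + 3)) (hab : a ≤ b) (h : ∃ k, k ≠ i ∧ k ≠ a ∧ k ≠ b) :
    fromVertex g a ≫ map g a b hab h = fromVertex g b := by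
  unfold fromVertex
  by_cases ha : i ≤ a
  · rw [dif_pos ha, dif_pos (ha.trans hab)]
    exact map_comp g _ _ _ _ _ (h.imp fun k hk => ⟨hk.1, hk.1, hk.2⟩) _ _ _
  · rw [dif_neg ha]
    by_cases hb : i ≤ b
    · rw [dif_pos hb, Groupoid.inv_eq_inv, IsIso.inv_comp_eq]
      exact (map_comp g _ _ _ _ _ (h.imp fun k hk => ⟨hk.1, hk.2.1, hk.1, hk.2.2⟩) _ _ _).symm
    · rw [dif_neg hb, Groupoid.inv_eq_inv, Groupoid.inv_eq_inv, IsIso.inv_comp_eq,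
        IsIso.eq_comp_inv]
      exact map_comp g _ _ _ _ _ (h.imp fun k hk => ⟨hk.1, hk.2.1, hk.2.2, hk.1⟩) _ _ _

/-- The filler of a horn in the nerve of a groupoid. -/
noncomputable def filler : Fin (n + 3) ⥤ G where
  obj := obj g
  -- Passing through the horn vertex `i` makes functoriality automatic and also defines the edges
  -- that the horn lacks.
  map {a b} _ := Groupoid.inv (fromVertex g a) ≫ fromVertex g b

/-- A simplex of a nerve is determined by its arrows. Those of the face opposite `j ≠ i` miss `j`,
so they are edges of the horn, where `fromVertex_comp_map` applies. -/
lemma map_filler_face (j : Fin (n + 3)) (hj : j ≠ i) :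
    (nerve G).map (SimplexCategory.δ j).op (filler g) = g.app _ (SSet.horn.face i j hj) := by
  refine Arrow.functor_ext fun x y f => ?_
  have hxy : (SimplexCategory.δ j) x ≤ (SimplexCategory.δ j) y :=
    (SimplexCategory.δ j).toOrderHom.monotone (leOfHom f)
  have hk : ∃ k, k ≠ i ∧ k ≠ (SimplexCategory.δ j) x ∧ k ≠ (SimplexCategory.δ j) y :=
    ⟨j, hj, (Fin.succAbove_ne _ _).symm, (Fin.succAbove_ne _ _).symm⟩
  have h₁ : (filler g).map (homOfLE hxy) = map g _ _ hxy hk := by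
    change Groupoid.inv _ ≫ _ = _
    rw [Groupoid.inv_eq_inv, IsIso.inv_comp_eq, fromVertex_comp_map]
  change Arrow.mk ((filler g).map (homOfLE hxy)) = _
  rw [h₁]
  refine (nerve.arrow_mk_homEquiv _).trans ?_
  have h₂ : (edge (i := i) _ _ hxy hk).edge = (Λ[n + 2, i] : SSet.{u}).map
      (SimplexCategory.mkOfLe x y (leOfHom f)).op (SSet.horn.face i j hj) := by
    apply Subtype.ext
    ext z
    fin_cases z <;> rfl
  rw [SSet.Edge.map_edge, h₂]
  have h₃ := NatTrans.naturality_apply g (SimplexCategory.mkOfLe x y (leOfHom f)).op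
    (SSet.horn.face i j hj)
  exact congr_arg (fun e : ComposableArrows G 1 => Arrow.mk e.hom) h₃

end groupoidHorn

instance kanComplex_nerve (G : Type u) [Groupoid.{u} G] : SSet.KanComplex (nerve G) := by
  rw [SSet.KanComplex.iff]
  rintro (_ | n) i f hf
  -- A horn in `Δ[1]` is a single vertex, filled by its degenerate edge.
  · obtain ⟨j, hj⟩ : ∃ j, j ≠ i := exists_ne i
    refine ⟨SSet.stdSimplex.σ 0 ≫ f j hj, fun k hk => ?_⟩
    obtain rfl : k = j := by omega
    rw [← Category.assoc]
    convert Category.id_comp _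
    exact SSet.stdSimplex.isTerminalObj₀.hom_ext _ _
  · refine ⟨SSet.yonedaEquiv.symm (groupoidHorn.filler hf.desc), fun j hj => ?_⟩
    rw [← hf.ι_desc j hj]
    apply SSet.yonedaEquiv.injective
    refine Eq.trans ?_ ((groupoidHorn.map_filler_face hf.desc j hj).trans ?_)
    · exact congr_arg SSet.yonedaEquiv (SSet.yonedaEquiv_symm_naturality_left _ _)
        |>.trans (Equiv.apply_symm_apply _ _)
    · rw [SSet.yonedaEquiv_comp, SSet.horn.yonedaEquiv_ι]

end CategoryTheory

/-! ### Equivalences of categories and weak equivalences of classifying diagrams. -/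

namespace classifyingDiagram

lemma isEquivalence_core {C D : Type u} [Category.{u} C] [Category.{u} D] (F : C ⥤ D)
    [F.IsEquivalence] : F.core.IsEquivalence :=
  F.asEquivalence.core.isEquivalence_functor

/-- A functor is an equivalence if and only if it induces a weak equivalence of classifying
diagrams. -/
theorem isEquivalence_iff {C D : Cat.{u, u}} (f : C ⟶ D) :
    f.toFunctor.IsEquivalence ↔
      SimplicialSpace.IsWeakEquivalence (classifyingDiagram.map f) := by
  constructor
  · intro _ m
    have : ((Functor.whiskeringRight (Fin (m + 1)) _ _).obj f.toFunctor).IsEquivalence :=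
      inferInstance
    have := isEquivalence_core ((Functor.whiskeringRight (Fin (m + 1)) _ _).obj f.toFunctor)
    exact isWeakEquivalence_nerveMap _
  · intro h
    exact isEquivalence_of_core _ (isEquivalence_of_isWeakEquivalence_nerveMap _ (h 0))
      (isEquivalence_of_isWeakEquivalence_nerveMap _ (h 1))

end classifyingDiagram

namespace CategoryTheory

/-- Transports a commutative square along equalities of its sides without casts between endpoints.
-/
lemma comm_square_of_arrow_eq {D : Type*} [Category* D] {a b c d a' b' c' d' : D}
    {f : a ⟶ b} {r : b ⟶ d} {l : a ⟶ c} {g : c ⟶ d}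
    {f' : a' ⟶ b'} {r' : b' ⟶ d'} {l' : a' ⟶ c'} {g' : c' ⟶ d'}
    (hf : Arrow.mk f = Arrow.mk f') (hr : Arrow.mk r = Arrow.mk r')
    (hl : Arrow.mk l = Arrow.mk l') (hg : Arrow.mk g = Arrow.mk g')
    (h : f' ≫ r' = l' ≫ g') : f ≫ r = l ≫ g := by
  rw [Arrow.mk_eq_mk_iff] at hf hr hl hg
  obtain ⟨rfl, rfl, rfl⟩ := hf
  obtain ⟨-, rfl, rfl⟩ := hr
  obtain ⟨-, rfl, rfl⟩ := hl
  obtain ⟨-, -, rfl⟩ := hg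
  simpa using h

end CategoryTheory

/-! ### Operators that select vertices, edges and triangles. -/

namespace SimplexCategory

/-- The vertex `i` of `⦋m⦌`. -/
def vertexMap (m : SimplexCategory) (i : Fin (m.len + 1)) : ⦋0⦌ ⟶ m := SimplexCategory.const _ _ i

/-- The edge `i ≤ j` of `⦋m⦌`. -/
def edgeMap (m : SimplexCategory) {i j : Fin (m.len + 1)} (h : i ≤ j) : ⦋1⦌ ⟶ m :=
  SimplexCategory.mkOfLe i j h

/-- The triangle `i ≤ j ≤ k` of `⦋m⦌`. -/
def triangleMap (m : SimplexCategory) {i j k : Fin (m.len + 1)} (h : i ≤ j) (h' : j ≤ k) : ⦋2⦌ ⟶ m :=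
  SimplexCategory.mkOfLeComp i j k h h'

lemma vertexMap_comp {m n : SimplexCategory} (i : Fin (m.len + 1)) (f : m ⟶ n) :
    vertexMap m i ≫ f = vertexMap n (f i) := rfl

lemma edgeMap_comp {m n : SimplexCategory} {i j : Fin (m.len + 1)} (h : i ≤ j) (f : m ⟶ n) :
    edgeMap m h ≫ f = edgeMap n (f.toOrderHom.monotone h) := by
  ext x
  fin_cases x <;> rfl

lemma δ_one_edgeMap {m : SimplexCategory} {i j : Fin (m.len + 1)} (h : i ≤ j) :
    δ (1 : Fin 2) ≫ edgeMap m h = vertexMap m i := by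
  ext x
  fin_cases x
  rfl

lemma δ_zero_edgeMap {m : SimplexCategory} {i j : Fin (m.len + 1)} (h : i ≤ j) :
    δ (0 : Fin 2) ≫ edgeMap m h = vertexMap m j := by
  ext x
  fin_cases x
  rfl

lemma δ_two_triangleMap {m : SimplexCategory} {i j k : Fin (m.len + 1)} (h : i ≤ j) (h' : j ≤ k) :
    δ (2 : Fin 3) ≫ triangleMap m h h' = edgeMap m h := by
  ext x
  fin_cases x <;> rfl

lemma δ_zero_triangleMap {m : SimplexCategory} {i j k : Fin (m.len + 1)} (h : i ≤ j) (h' : j ≤ k) :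
    δ (0 : Fin 3) ≫ triangleMap m h h' = edgeMap m h' := by
  ext x
  fin_cases x <;> rfl

lemma δ_one_triangleMap {m : SimplexCategory} {i j k : Fin (m.len + 1)} (h : i ≤ j) (h' : j ≤ k) :
    δ (1 : Fin 3) ≫ triangleMap m h h' = edgeMap m (h.trans h') := by
  ext x
  fin_cases x <;> rfl

lemma σ_vertexMap {m : SimplexCategory} (i : Fin (m.len + 1)) :
    σ (0 : Fin 1) ≫ vertexMap m i = edgeMap m (le_refl i) := by
  ext x
  fin_cases x <;> rfl

lemma vertexMap_zero : vertexMap ⦋0⦌ 0 = 𝟙 _ := by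
  ext x
  fin_cases x
  rfl

lemma edgeMap_zero_one : edgeMap ⦋1⦌ (Fin.zero_le 1) = 𝟙 _ := by
  ext x
  fin_cases x <;> rfl

end SimplexCategory

/-! ### Grid functors and the grids they produce. -/

namespace SimplicialSpace

open SimplexCategory

/-- The set of `(m, n)`-simplices of a simplicial space. -/
abbrev S (Z : SimplicialSpace.{u}) (m n : SimplexCategory) : Type u := (Z.obj (op m)).obj (op n)

/-- The simplicial set of vertices of the spaces of a simplicial space. -/
abbrev row (Z : SimplicialSpace.{u}) : SSet.{u} where
  obj m := (Z.obj m).obj (op ⦋0⦌)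
  map f := (Z.map f).app _

/-- The initial space of a simplicial space. -/
abbrev col (Z : SimplicialSpace.{u}) : SSet.{u} := Z.obj (op ⦋0⦌)

/-- The action of a pair of simplicial operators. -/
def bi (Z : SimplicialSpace.{u}) {m n p q : SimplexCategory} (a : p ⟶ m) (b : q ⟶ n) (z : Z.S m n) :
    Z.S p q := (Z.obj _).map b.op ((Z.map a.op).app _ z)

section

variable {Z W : SimplicialSpace.{u}} {m n p q r s : SimplexCategory}

lemma bi_bi (a : p ⟶ m) (b : q ⟶ n) (a' : r ⟶ p) (b' : s ⟶ q) (z : Z.S m n) :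
    Z.bi a' b' (Z.bi a b z) = Z.bi (a' ≫ a) (b' ≫ b) z := by
  simp [bi]

lemma bi_app (φ : Z ⟶ W) (a : p ⟶ m) (b : q ⟶ n) (z : Z.S m n) :
    W.bi a b ((φ.app _).app _ z) = (φ.app _).app _ (Z.bi a b z) := by
  have h := congr_arg (fun t => t.app (op n) z) (φ.naturality a.op)
  have h' := NatTrans.naturality_apply (φ.app (op p)) b.op ((Z.map a.op).app _ z)
  refine Eq.trans ?_ h'.symm
  exact congr_arg ((W.obj (op p)).map b.op) h.symm

lemma row_map (a : p ⟶ m) (z : Z.S m ⦋0⦌) : Z.row.map a.op z = Z.bi a (𝟙 _) z := by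
  simp [bi]

lemma col_map (b : q ⟶ n) (z : Z.S ⦋0⦌ n) : Z.col.map b.op z = Z.bi (𝟙 _) b z := by
  simp [bi]

/-- The vertex `(i, j)` of an `(m, n)`-simplex. -/
def vertex (z : Z.S m n) (i : Fin (m.len + 1)) (j : Fin (n.len + 1)) : Z.S ⦋0⦌ ⦋0⦌ :=
  Z.bi (vertexMap m i) (vertexMap n j) z

/-- The horizontal edges of an `(m, n)`-simplex. -/
def rowEdge (z : Z.S m n) {i i' : Fin (m.len + 1)} (h : i ≤ i') (j : Fin (n.len + 1)) :
    Z.row.Edge (vertex z i j) (vertex z i' j) :=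
  SSet.Edge.mk (Z.bi (edgeMap m h) (vertexMap n j) z)
    ((row_map _ _).trans (by rw [bi_bi, δ_one_edgeMap, Category.id_comp]; rfl))
    ((row_map _ _).trans (by rw [bi_bi, δ_zero_edgeMap, Category.id_comp]; rfl))

/-- The vertical edges of an `(m, n)`-simplex. -/
def colEdge (z : Z.S m n) (i : Fin (m.len + 1)) {j j' : Fin (n.len + 1)} (h : j ≤ j') :
    Z.col.Edge (vertex z i j) (vertex z i j') :=
  SSet.Edge.mk (Z.bi (vertexMap m i) (edgeMap n h) z)
    ((col_map _ _).trans (by rw [bi_bi, δ_one_edgeMap, Category.id_comp]; rfl))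
    ((col_map _ _).trans (by rw [bi_bi, δ_zero_edgeMap, Category.id_comp]; rfl))

lemma rowEdge_refl (z : Z.S m n) (i : Fin (m.len + 1)) (j : Fin (n.len + 1)) :
    rowEdge z (le_refl i) j = SSet.Edge.id (X := Z.row) (vertex z i j) := by
  apply SSet.Edge.ext
  refine Eq.trans ?_ (row_map (σ 0) _).symm
  unfold vertex
  rw [bi_bi, σ_vertexMap, Category.id_comp]
  rfl

lemma colEdge_refl (z : Z.S m n) (i : Fin (m.len + 1)) (j : Fin (n.len + 1)) :
    colEdge z i (le_refl j) = SSet.Edge.id (X := Z.col) (vertex z i j) := by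
  apply SSet.Edge.ext
  refine Eq.trans ?_ (col_map (σ 0) _).symm
  unfold vertex
  rw [bi_bi, σ_vertexMap, Category.id_comp]
  rfl

/-- The horizontal triangles of an `(m, n)`-simplex. -/
def rowTriangle (z : Z.S m n) {i i' i'' : Fin (m.len + 1)} (h : i ≤ i') (h' : i' ≤ i'')
    (j : Fin (n.len + 1)) :
    SSet.Edge.CompStruct (rowEdge z h j) (rowEdge z h' j) (rowEdge z (h.trans h') j) :=
  SSet.Edge.CompStruct.mk (Z.bi (triangleMap m h h') (vertexMap n j) z)
    ((row_map _ _).trans (by rw [bi_bi, δ_two_triangleMap, Category.id_comp]; rfl))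
    ((row_map _ _).trans (by rw [bi_bi, δ_zero_triangleMap, Category.id_comp]; rfl))
    ((row_map _ _).trans (by rw [bi_bi, δ_one_triangleMap, Category.id_comp]; rfl))

/-- The vertical triangles of an `(m, n)`-simplex. -/
def colTriangle (z : Z.S m n) (i : Fin (m.len + 1)) {j j' j'' : Fin (n.len + 1)} (h : j ≤ j')
    (h' : j' ≤ j'') :
    SSet.Edge.CompStruct (colEdge z i h) (colEdge z i h') (colEdge z i (h.trans h')) :=
  SSet.Edge.CompStruct.mk (Z.bi (vertexMap m i) (triangleMap n h h') z)
    ((col_map _ _).trans (by rw [bi_bi, δ_two_triangleMap, Category.id_comp]; rfl))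
    ((col_map _ _).trans (by rw [bi_bi, δ_zero_triangleMap, Category.id_comp]; rfl))
    ((col_map _ _).trans (by rw [bi_bi, δ_one_triangleMap, Category.id_comp]; rfl))

end

/-- The data of a map from a simplicial space to a classifying diagram, in low degrees. -/
structure GridFunctor (Z : SimplicialSpace.{u}) (D : Type u) [Category.{u} D] where
  /-- The image of a vertex. -/
  obj : Z.S ⦋0⦌ ⦋0⦌ → D
  /-- The image of a horizontal edge. -/
  hor {x y : Z.S ⦋0⦌ ⦋0⦌} (e : Z.row.Edge x y) : obj x ⟶ obj y
  /-- The image of a vertical edge. -/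
  ver {x y : Z.S ⦋0⦌ ⦋0⦌} (e : Z.col.Edge x y) : obj x ≅ obj y
  hor_id (x : Z.S ⦋0⦌ ⦋0⦌) : hor (SSet.Edge.id (X := Z.row) x) = 𝟙 _
  ver_id (x : Z.S ⦋0⦌ ⦋0⦌) : (ver (SSet.Edge.id (X := Z.col) x)).hom = 𝟙 _
  hor_comp {x y z : Z.S ⦋0⦌ ⦋0⦌} {e : Z.row.Edge x y} {f : Z.row.Edge y z} {g : Z.row.Edge x z}
    (h : SSet.Edge.CompStruct e f g) : hor e ≫ hor f = hor g
  ver_comp {x y z : Z.S ⦋0⦌ ⦋0⦌} {e : Z.col.Edge x y} {f : Z.col.Edge y z} {g : Z.col.Edge x z}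
    (h : SSet.Edge.CompStruct e f g) : (ver e).hom ≫ (ver f).hom = (ver g).hom
  square {x y x' y' : Z.S ⦋0⦌ ⦋0⦌} {t : Z.row.Edge x y} {b : Z.row.Edge x' y'}
    {l : Z.col.Edge x x'} {r : Z.col.Edge y y'} (s : Z.S ⦋1⦌ ⦋1⦌)
    (ht : t.edge = Z.bi (𝟙 _) (δ 1) s) (hb : b.edge = Z.bi (𝟙 _) (δ 0) s)
    (hl : l.edge = Z.bi (δ 1) (𝟙 _) s) (hr : r.edge = Z.bi (δ 0) (𝟙 _) s) :
    hor t ≫ (ver r).hom = (ver l).hom ≫ hor b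

namespace GridFunctor

variable {Z : SimplicialSpace.{u}} {D : Type u} [Category.{u} D] (E : GridFunctor Z D)

lemma arrow_hor_congr {x y x' y' : Z.S ⦋0⦌ ⦋0⦌} {e : Z.row.Edge x y} {e' : Z.row.Edge x' y'}
    (h : e.edge = e'.edge) : Arrow.mk (E.hor e) = Arrow.mk (E.hor e') := by
  obtain rfl : x = x' := by rw [← e.src_eq, ← e'.src_eq, h]
  obtain rfl : y = y' := by rw [← e.tgt_eq, ← e'.tgt_eq, h]
  rw [SSet.Edge.ext h]

lemma arrow_ver_congr {x y x' y' : Z.S ⦋0⦌ ⦋0⦌} {e : Z.col.Edge x y} {e' : Z.col.Edge x' y'}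
    (h : e.edge = e'.edge) : Arrow.mk (E.ver e).hom = Arrow.mk (E.ver e').hom := by
  obtain rfl : x = x' := by rw [← e.src_eq, ← e'.src_eq, h]
  obtain rfl : y = y' := by rw [← e.tgt_eq, ← e'.tgt_eq, h]
  rw [SSet.Edge.ext h]

variable {m n : SimplexCategory}

lemma square_simplex (z : Z.S m n) {i i' : Fin (m.len + 1)} (h : i ≤ i') {j j' : Fin (n.len + 1)}
    (h' : j ≤ j') :
    E.hor (rowEdge z h j) ≫ (E.ver (colEdge z i' h')).hom =
      (E.ver (colEdge z i h')).hom ≫ E.hor (rowEdge z h j') := by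
  apply E.square (Z.bi (edgeMap m h) (edgeMap n h') z)
  all_goals
    rw [bi_bi]
    simp only [δ_one_edgeMap, δ_zero_edgeMap, Category.id_comp]
    rfl

/-- The chain of objects in a given row of a simplex. -/
def rowObj (z : Z.S m n) (j : Fin (n.len + 1)) : Fin (m.len + 1) ⥤ D where
  obj i := E.obj (vertex z i j)
  map f := E.hor (rowEdge z (leOfHom f) j)
  map_id i := (congr_arg E.hor (rowEdge_refl z i j)).trans (E.hor_id _)
  map_comp f g := (E.hor_comp (rowTriangle z (leOfHom f) (leOfHom g) j)).symm

/-- The isomorphisms between the rows of a simplex. -/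
def rowIso (z : Z.S m n) {j j' : Fin (n.len + 1)} (h : j ≤ j') : E.rowObj z j ≅ E.rowObj z j' :=
  NatIso.ofComponents (fun i => E.ver (colEdge z i h)) (fun f => E.square_simplex z (leOfHom f) h)

/-- The simplex of the classifying diagram associated to a simplex. -/
def simplex (z : Z.S m n) : Fin (n.len + 1) ⥤ Core (Fin (m.len + 1) ⥤ D) where
  obj j := ⟨E.rowObj z j⟩
  map f := ⟨E.rowIso z (leOfHom f)⟩
  map_id j := by
    ext i
    exact (congr_arg (fun e => (E.ver e).hom) (colEdge_refl z i j)).trans (E.ver_id _)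
  map_comp f g := by
    ext i
    exact (E.ver_comp (colTriangle z i (leOfHom f) (leOfHom g))).symm

end GridFunctor

end SimplicialSpace

/-! ### Maps into a classifying diagram. -/

namespace classifyingDiagram

open SimplexCategory SimplicialSpace

variable {D : Cat.{u, u}} {m n p q : SimplexCategory}

/-- The horizontal arrows of a simplex of a classifying diagram. -/
def horArrow (s : (classifyingDiagram.obj D).S m n) {i i' : Fin (m.len + 1)} (h : i ≤ i')
    (j : Fin (n.len + 1)) : Arrow D :=
  Arrow.mk ((s.obj j).of.map (homOfLE h))

/-- The vertical arrows of a simplex of a classifying diagram. -/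
def verArrow (s : (classifyingDiagram.obj D).S m n) (i : Fin (m.len + 1)) {j j' : Fin (n.len + 1)}
    (h : j ≤ j') : Arrow D :=
  Arrow.mk ((s.map (homOfLE h)).iso.hom.app i)

lemma arrow_core_ext {J : Type*} [Category* J] {D : Type*} [Category* D] {X Y X' Y' : Core (J ⥤ D)}
    (hX : X = X') (hY : Y = Y') (f : X ⟶ Y) (f' : X' ⟶ Y')
    (h : ∀ i, Arrow.mk (f.iso.hom.app i) = Arrow.mk (f'.iso.hom.app i)) :
    Arrow.mk f = Arrow.mk f' := by
  subst hX hY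
  congr 1
  ext i
  exact Arrow.mk_injective _ _ (h i)

/-- Horizontal arrows determine each row as a functor, in particular the objects of the grid;
vertical arrows determine the isomorphisms between rows. -/
lemma simplex_ext {s t : (classifyingDiagram.obj D).S m n}
    (hh : ∀ {i i' : Fin (m.len + 1)} (h : i ≤ i') j, horArrow s h j = horArrow t h j)
    (hv : ∀ i {j j' : Fin (n.len + 1)} (h : j ≤ j'), verArrow s i h = verArrow t i h) : s = t := by
  have ho (j : Fin (n.len + 1)) : s.obj j = t.obj j := by
    have : (s.obj j).of = (t.obj j).of := Arrow.functor_ext fun i i' f => hh (leOfHom f) j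
    exact congr_arg Core.mk this
  exact Arrow.functor_ext fun j j' f =>
    arrow_core_ext (ho j) (ho j') _ _ fun i => hv i (leOfHom f)

/-- Every arrow of the grid `φ z` is, by naturality, the value of `φ` on an edge of `z`. -/
lemma hom_ext {Z : SimplicialSpace.{u}} {φ ψ : Z ⟶ classifyingDiagram.obj D}
    (hh : ∀ z : Z.S ⦋1⦌ ⦋0⦌, horArrow ((φ.app _).app _ z) (Fin.zero_le 1) 0 =
      horArrow ((ψ.app _).app _ z) (Fin.zero_le 1) 0)
    (hv : ∀ z : Z.S ⦋0⦌ ⦋1⦌, verArrow ((φ.app _).app _ z) 0 (Fin.zero_le 1) =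
      verArrow ((ψ.app _).app _ z) 0 (Fin.zero_le 1)) : φ = ψ := by
  apply NatTrans.ext
  funext ⟨m⟩
  apply NatTrans.ext
  funext ⟨n⟩
  ext z
  refine simplex_ext (fun {i i'} h j => ?_) (fun i {j j'} h => ?_)
  · have := hh (Z.bi (edgeMap m h) (vertexMap n j) z)
    rw [← bi_app, ← bi_app] at this
    exact this
  · have := hv (Z.bi (vertexMap m i) (edgeMap n h) z)
    rw [← bi_app, ← bi_app] at this
    exact this

variable (D) in
/-- The row of a classifying diagram projects to the nerve. -/
def rowToNerve : (classifyingDiagram.obj D).row ⟶ nerve D where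
  app m := ↾fun s => (s.obj (0 : Fin 1)).of

variable (D) in
/-- The initial space of a classifying diagram projects to the nerve of the core. -/
def colToNerve : (classifyingDiagram.obj D).col ⟶ nerve (Core D) :=
  nerveMap ((evaluation (Fin 1) D).obj 0).core

end classifyingDiagram

lemma CategoryTheory.nerve.arrow_mk_homEquiv_core {C : Type u} [Category.{u} C]
    {x y : ComposableArrows (Core C) 0} (e : (nerve (Core C)).Edge x y) :
    Arrow.mk (CoreHom.iso (nerve.homEquiv e)).hom =
      Arrow.mk (CoreHom.iso (ComposableArrows.hom (n := 1) e.edge)).hom :=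
  congr_arg (Core.inclusion C).mapArrow.obj (nerve.arrow_mk_homEquiv e)

namespace SimplicialSpace

open classifyingDiagram SimplexCategory

variable {Z W : SimplicialSpace.{u}} {D : Cat.{u, u}}

/-- The map of rows induced by a map of simplicial spaces. -/
abbrev rowMap (φ : Z ⟶ W) : Z.row ⟶ W.row where
  app m := (φ.app m).app _
  naturality m n f := by
    have := congr_arg (fun t => t.app (op ⦋0⦌)) (φ.naturality f)
    exact this

/-- The grid functor of a map to a classifying diagram. -/
def toGridFunctor (φ : Z ⟶ classifyingDiagram.obj D) : GridFunctor Z D where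
  obj x := nerveEquiv ((rowMap φ ≫ rowToNerve D).app _ x)
  hor e := nerve.homEquiv (e.map (rowMap φ ≫ rowToNerve D))
  ver e := (nerve.homEquiv (e.map (φ.app _ ≫ colToNerve D))).iso
  hor_id x := by
    rw [SSet.Edge.map_id]
    exact nerve.homEquiv_id _
  ver_id x := by
    rw [SSet.Edge.map_id]
    exact congr_arg (fun t => (CoreHom.iso t).hom) (nerve.homEquiv_id (C := Core D) _)
  hor_comp h := nerve.homEquiv_comp (h.map (rowMap φ ≫ rowToNerve D))
  ver_comp h := congr_arg (fun t => (CoreHom.iso t).hom)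
    (nerve.homEquiv_comp (C := Core D) (h.map (φ.app _ ≫ colToNerve D)))
  square {x y x' y' t b l r} s ht hb hl hr := by
    -- The square is the naturality square of the vertical isomorphism in the grid `φ s`.
    have h := ((((φ.app _).app _ s).map (homOfLE (Fin.zero_le (1 : Fin 2)))).iso.hom.naturality
      (homOfLE (Fin.zero_le (1 : Fin 2))))
    refine comm_square_of_arrow_eq ((nerve.arrow_mk_homEquiv _).trans ?_)
      ((nerve.arrow_mk_homEquiv_core _).trans ?_)
      ((nerve.arrow_mk_homEquiv_core _).trans ?_)
      ((nerve.arrow_mk_homEquiv _).trans ?_) h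
    · change horArrow ((φ.app _).app _ t.edge) (Fin.zero_le 1) 0 = _
      rw [ht, ← bi_app]
      rfl
    · change verArrow ((φ.app _).app _ r.edge) 0 (Fin.zero_le 1) = _
      rw [hr, ← bi_app]
      rfl
    · change verArrow ((φ.app _).app _ l.edge) 0 (Fin.zero_le 1) = _
      rw [hl, ← bi_app]
      rfl
    · change horArrow ((φ.app _).app _ b.edge) (Fin.zero_le 1) 0 = _
      rw [hb, ← bi_app]
      rfl

lemma arrow_toGridFunctor_hor (φ : Z ⟶ classifyingDiagram.obj D) {x y : Z.S ⦋0⦌ ⦋0⦌}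
    (e : Z.row.Edge x y) : Arrow.mk ((toGridFunctor φ).hor e) =
      horArrow ((φ.app _).app _ e.edge) (Fin.zero_le 1) 0 :=
  nerve.arrow_mk_homEquiv _

lemma arrow_toGridFunctor_ver (φ : Z ⟶ classifyingDiagram.obj D) {x y : Z.S ⦋0⦌ ⦋0⦌}
    (e : Z.col.Edge x y) : Arrow.mk ((toGridFunctor φ).ver e).hom =
      verArrow ((φ.app _).app _ e.edge) 0 (Fin.zero_le 1) :=
  nerve.arrow_mk_homEquiv_core (e.map (φ.app _ ≫ colToNerve D))

section

variable {m n p q : SimplexCategory}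

lemma rowEdge_bi_edge (z : Z.S m n) (a : p ⟶ m) (b : q ⟶ n) {i i' : Fin (p.len + 1)} (h : i ≤ i')
    (j : Fin (q.len + 1)) :
    (rowEdge (Z.bi a b z) h j).edge = (rowEdge z (a.toOrderHom.monotone h) (b j)).edge :=
  (bi_bi _ _ _ _ _).trans (by rw [edgeMap_comp, vertexMap_comp]; rfl)

lemma colEdge_bi_edge (z : Z.S m n) (a : p ⟶ m) (b : q ⟶ n) (i : Fin (p.len + 1))
    {j j' : Fin (q.len + 1)} (h : j ≤ j') :
    (colEdge (Z.bi a b z) i h).edge = (colEdge z (a i) (b.toOrderHom.monotone h)).edge :=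
  (bi_bi _ _ _ _ _).trans (by rw [edgeMap_comp, vertexMap_comp]; rfl)

/-- The edges of `Z.bi a b z` are edges of `z` with endpoints moved by `a` and `b`. This is the
naturality of `GridFunctor.toHom`. -/
lemma GridFunctor.simplex_bi (E : GridFunctor Z D) (z : Z.S m n) (a : p ⟶ m) (b : q ⟶ n) :
    E.simplex (Z.bi a b z) = (classifyingDiagram.obj D).bi a b (E.simplex z) :=
  simplex_ext (fun h j => E.arrow_hor_congr (rowEdge_bi_edge z a b h j))
    (fun i _ _ h => E.arrow_ver_congr (colEdge_bi_edge z a b i h))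

end

/-- The map to a classifying diagram associated to a grid functor. -/
def GridFunctor.toHom (E : GridFunctor Z D) : Z ⟶ classifyingDiagram.obj D where
  app m :=
    { app n := ↾fun z => E.simplex z
      naturality n n' f := by
        ext z
        have := E.simplex_bi z (𝟙 _) f.unop
        simpa [bi] using! this }
  naturality m m' f := by
    apply NatTrans.ext
    funext n
    ext z
    have := E.simplex_bi z f.unop (𝟙 _)
    simpa [bi] using! this

end SimplicialSpace

/-! ### Special simplices of a classifying diagram, and products. -/

namespace classifyingDiagram

open SimplexCategory SimplicialSpace

lemma core_map_id_app {K J D : Type*} [Category* K] [Category* J] [Category* D]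
    (s : K ⥤ Core (J ⥤ D)) (k : K) (i : J) : (s.map (𝟙 k)).iso.hom.app i = 𝟙 _ := by
  simp

lemma core_map_comp_app {K J D : Type*} [Category* K] [Category* J] [Category* D]
    (s : K ⥤ Core (J ⥤ D)) {k k' k'' : K} (f : k ⟶ k') (g : k' ⟶ k'') (i : J) :
    (s.map (f ≫ g)).iso.hom.app i = (s.map f).iso.hom.app i ≫ (s.map g).iso.hom.app i := by
  simp

section

variable {C : Cat.{u, u}}

/-- The horizontal arrows of a `(0, 1)`-simplex are identities on the ends of its vertical arrow, so
they carry no further information. -/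
lemma edge_ext_ver {s t : (classifyingDiagram.obj C).S ⦋0⦌ ⦋1⦌}
    (h : verArrow s 0 (Fin.zero_le 1) = verArrow t 0 (Fin.zero_le 1)) : s = t := by
  have id_hor (s : (classifyingDiagram.obj C).S ⦋0⦌ ⦋1⦌) (j : Fin 2) :
      horArrow s (le_refl (0 : Fin 1)) j = Arrow.mk (𝟙 ((s.obj j).of.obj 0)) :=
    congr_arg Arrow.mk ((s.obj j).of.map_id 0)
  have id_ver (s : (classifyingDiagram.obj C).S ⦋0⦌ ⦋1⦌) (j : Fin 2) :
      verArrow s 0 (le_refl j) = Arrow.mk (𝟙 ((s.obj j).of.obj (0 : Fin 1))) :=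
    congr_arg Arrow.mk (core_map_id_app s j (0 : Fin 1))
  have h₀ : Arrow.mk (𝟙 ((s.obj (0 : Fin 2)).of.obj (0 : Fin 1))) =
      Arrow.mk (𝟙 ((t.obj (0 : Fin 2)).of.obj (0 : Fin 1))) :=
    congr_arg (fun a : Arrow C => Arrow.mk (𝟙 a.left)) h
  have h₁ : Arrow.mk (𝟙 ((s.obj (1 : Fin 2)).of.obj (0 : Fin 1))) =
      Arrow.mk (𝟙 ((t.obj (1 : Fin 2)).of.obj (0 : Fin 1))) :=
    congr_arg (fun a : Arrow C => Arrow.mk (𝟙 a.right)) h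
  refine simplex_ext (fun {i i'} hi (j : Fin 2) => ?_) (fun i {j j'} hj => ?_)
  · obtain rfl : i = (0 : Fin 1) := Subsingleton.elim (α := Fin 1) _ _
    obtain rfl : i' = (0 : Fin 1) := Subsingleton.elim (α := Fin 1) _ _
    refine (id_hor s j).trans (Eq.trans ?_ (id_hor t j).symm)
    fin_cases j
    · exact h₀
    · exact h₁
  · obtain rfl : i = (0 : Fin 1) := Subsingleton.elim (α := Fin 1) _ _
    change Fin 2 at j j'
    obtain rfl | ⟨rfl, rfl⟩ : j = j' ∨ (j = 0 ∧ j' = 1) := by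
      revert hj
      revert j j'
      decide
    · refine (id_ver s j).trans (Eq.trans ?_ (id_ver t j).symm)
      fin_cases j
      · exact h₀
      · exact h₁
    · exact h

variable (C) in
/-- The nerve as the row of a classifying diagram. -/
def nerveToRow : nerve C ⟶ (classifyingDiagram.obj C).row where
  app m := ↾fun s => (Functor.const (Fin 1)).obj ⟨s⟩

/-- In vertical degree 0 the only vertical arrows are identities, so the row of `N C` is the nerve
of `C`. -/
lemma nerveToRow_rowToNerve {m : SimplexCategory} (s : (classifyingDiagram.obj C).S m ⦋0⦌) :
    (nerveToRow C).app _ ((rowToNerve C).app _ s) = s := by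
  refine simplex_ext (fun {i i'} hi j => ?_) (fun i {j j'} hj => ?_)
  · obtain rfl : j = (0 : Fin 1) := Subsingleton.elim (α := Fin 1) _ _
    rfl
  · obtain rfl : j = (0 : Fin 1) := Subsingleton.elim (α := Fin 1) _ _
    obtain rfl : j' = (0 : Fin 1) := Subsingleton.elim (α := Fin 1) _ _
    exact (congr_arg Arrow.mk (core_map_id_app s (0 : Fin 1) i)).symm

/-- The vertex of a classifying diagram associated to an object. -/
def objVertex (c : C) : (classifyingDiagram.obj C).S ⦋0⦌ ⦋0⦌ :=
  (nerveToRow C).app _ (nerveEquiv.symm c)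

/-- The horizontal edge of a classifying diagram associated to a morphism. -/
def homEdge {c d : C} (f : c ⟶ d) :
    (classifyingDiagram.obj C).row.Edge (objVertex c) (objVertex d) :=
  (nerve.edgeMk f).map (nerveToRow C)

lemma homEdge_id (c : C) :
    homEdge (𝟙 c) = SSet.Edge.id (X := (classifyingDiagram.obj C).row) (objVertex c) := by
  unfold homEdge
  rw [nerve.edgeMk_id]
  exact SSet.Edge.map_id _ _

lemma nonempty_homEdge_comp {c d e : C} (f : c ⟶ d) (g : d ⟶ e) :
    Nonempty (SSet.Edge.CompStruct (homEdge f) (homEdge g) (homEdge (f ≫ g))) :=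
  ((nerve.nonempty_compStruct_iff f g (f ≫ g)).2 rfl).map fun h => h.map (nerveToRow C)

lemma homEdge_edge (s : (classifyingDiagram.obj C).S ⦋1⦌ ⦋0⦌) :
    (homEdge ((s.obj (0 : Fin 1)).of.map (homOfLE (Fin.zero_le (1 : Fin 2))))).edge = s := by
  refine Eq.trans ?_ (nerveToRow_rowToNerve s)
  exact congr_arg ((nerveToRow C).app _) (ComposableArrows.mk₁_hom ((s.obj (0 : Fin 1)).of))

/-- The square with an isomorphism on top and left and identities on the right and bottom. -/
def isoSquare {c d : C} (e : c ≅ d) : (classifyingDiagram.obj C).S ⦋1⦌ ⦋1⦌ :=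
  ComposableArrows.mk₁ (C := Core (Fin 2 ⥤ C)) (X₀ := ⟨ComposableArrows.mk₁ e.hom⟩)
    (X₁ := ⟨ComposableArrows.mk₁ (𝟙 d)⟩) ⟨ComposableArrows.isoMk₁ e (Iso.refl d) rfl⟩

lemma isoSquare_top {c d : C} (e : c ≅ d) :
    (classifyingDiagram.obj C).bi (𝟙 _) (δ 1) (isoSquare e) = (homEdge e.hom).edge := by
  refine Eq.trans (nerveToRow_rowToNerve _).symm ?_
  rfl

lemma isoSquare_bot {c d : C} (e : c ≅ d) :
    (classifyingDiagram.obj C).bi (𝟙 _) (δ 0) (isoSquare e) = (homEdge (𝟙 d)).edge := by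
  refine Eq.trans (nerveToRow_rowToNerve _).symm ?_
  rfl

/-- Every vertical edge is the left side of a square whose top is the same isomorphism taken
horizontally and whose other sides are degenerate. Vertical data on `N C` thus reduce to horizontal
data. -/
lemma isoSquare_left (s : (classifyingDiagram.obj C).S ⦋0⦌ ⦋1⦌) :
    (classifyingDiagram.obj C).bi (δ 1) (𝟙 _)
      (isoSquare ((s.map (homOfLE (Fin.zero_le (1 : Fin 2)))).iso.app (0 : Fin 1))) = s :=
  edge_ext_ver rfl

lemma isoSquare_right {c d : C} (e : c ≅ d) :
    (classifyingDiagram.obj C).bi (δ 0) (𝟙 _) (isoSquare e) =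
      (SSet.Edge.id (X := (classifyingDiagram.obj C).col) (objVertex d)).edge :=
  edge_ext_ver rfl

end

/-- The isomorphism `N (C × D) ≅ N C × N D`. -/
def prodIso (C D : Cat.{u, u}) : classifyingDiagram.obj (Cat.of (C × D)) ≅
    classifyingDiagram.obj C ⊗ classifyingDiagram.obj D where
  hom := lift (classifyingDiagram.map (CategoryTheory.Prod.fst C D).toCatHom)
    (classifyingDiagram.map (CategoryTheory.Prod.snd C D).toCatHom)
  inv := { app := fun m => { app := fun n => ↾fun x =>
    { obj := fun j => ⟨(x.1.obj j).of.prod' (x.2.obj j).of⟩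
      map := fun f => ⟨(functorProdFunctorEquiv (Fin (m.unop.len + 1)) C D).functor.mapIso
        (Iso.prod (x.1.map f).iso (x.2.map f).iso)⟩
      map_id := fun j => by
        ext i
        exact Prod.ext (core_map_id_app x.1 j i) (core_map_id_app x.2 j i)
      map_comp := fun f g => by
        ext i
        exact Prod.ext (core_map_comp_app x.1 f g i) (core_map_comp_app x.2 f g i) } } }

end classifyingDiagram

/-! ### Currying of grid functors. -/

namespace SimplicialSpace

open SimplexCategory

variable {Z X Y : SimplicialSpace.{u}}

/-- The product of horizontal edges. -/
def rowTensor {x x' : X.S ⦋0⦌ ⦋0⦌} {y y' : Y.S ⦋0⦌ ⦋0⦌} (e : X.row.Edge x x')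
    (f : Y.row.Edge y y') : (X ⊗ Y).row.Edge (x, y) (x', y') :=
  SSet.Edge.mk (e.edge, f.edge) (Prod.ext e.src_eq f.src_eq) (Prod.ext e.tgt_eq f.tgt_eq)

/-- The product of vertical edges. -/
def colTensor {x x' : X.S ⦋0⦌ ⦋0⦌} {y y' : Y.S ⦋0⦌ ⦋0⦌} (e : X.col.Edge x x')
    (f : Y.col.Edge y y') : (X ⊗ Y).col.Edge (x, y) (x', y') :=
  SSet.Edge.mk (e.edge, f.edge) (Prod.ext e.src_eq f.src_eq) (Prod.ext e.tgt_eq f.tgt_eq)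

/-- The product of horizontal triangles. -/
def rowTensorComp {x x' x'' : X.S ⦋0⦌ ⦋0⦌} {y y' y'' : Y.S ⦋0⦌ ⦋0⦌} {e : X.row.Edge x x'}
    {e' : X.row.Edge x' x''} {e'' : X.row.Edge x x''} {f : Y.row.Edge y y'}
    {f' : Y.row.Edge y' y''} {f'' : Y.row.Edge y y''} (h : SSet.Edge.CompStruct e e' e'')
    (h' : SSet.Edge.CompStruct f f' f'') :
    SSet.Edge.CompStruct (rowTensor e f) (rowTensor e' f') (rowTensor e'' f'') :=
  SSet.Edge.CompStruct.mk (h.simplex, h'.simplex) (Prod.ext h.d₂ h'.d₂) (Prod.ext h.d₀ h'.d₀)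
    (Prod.ext h.d₁ h'.d₁)

/-- The product of vertical triangles. -/
def colTensorComp {x x' x'' : X.S ⦋0⦌ ⦋0⦌} {y y' y'' : Y.S ⦋0⦌ ⦋0⦌} {e : X.col.Edge x x'}
    {e' : X.col.Edge x' x''} {e'' : X.col.Edge x x''} {f : Y.col.Edge y y'}
    {f' : Y.col.Edge y' y''} {f'' : Y.col.Edge y y''} (h : SSet.Edge.CompStruct e e' e'')
    (h' : SSet.Edge.CompStruct f f' f'') :
    SSet.Edge.CompStruct (colTensor e f) (colTensor e' f') (colTensor e'' f'') :=
  SSet.Edge.CompStruct.mk (h.simplex, h'.simplex) (Prod.ext h.d₂ h'.d₂) (Prod.ext h.d₀ h'.d₀)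
    (Prod.ext h.d₁ h'.d₁)

/-- The square which is vertically degenerate on a horizontal edge. -/
abbrev rowSquare {x y : Z.S ⦋0⦌ ⦋0⦌} (e : Z.row.Edge x y) : Z.S ⦋1⦌ ⦋1⦌ := Z.bi (𝟙 _) (σ 0) e.edge

/-- The square which is horizontally degenerate on a vertical edge. -/
abbrev colSquare {x y : Z.S ⦋0⦌ ⦋0⦌} (e : Z.col.Edge x y) : Z.S ⦋1⦌ ⦋1⦌ := Z.bi (σ 0) (𝟙 _) e.edge

lemma bi_id {m n : SimplexCategory} (z : Z.S m n) : Z.bi (𝟙 _) (𝟙 _) z = z := by simp [bi]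

/-- The degenerate horizontal edge. -/
abbrev rowId (x : Z.S ⦋0⦌ ⦋0⦌) : Z.row.Edge x x := SSet.Edge.id (X := Z.row) x

/-- The degenerate vertical edge. -/
abbrev colId (x : Z.S ⦋0⦌ ⦋0⦌) : Z.col.Edge x x := SSet.Edge.id (X := Z.col) x

section

variable {x y : Z.S ⦋0⦌ ⦋0⦌}

lemma id_row_edge (x : Z.S ⦋0⦌ ⦋0⦌) :
    (SSet.Edge.id (X := Z.row) x).edge = Z.bi (σ 0) (𝟙 _) x := row_map (σ 0) x

lemma id_col_edge (x : Z.S ⦋0⦌ ⦋0⦌) :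
    (SSet.Edge.id (X := Z.col) x).edge = Z.bi (𝟙 _) (σ 0) x := col_map (σ 0) x

lemma row_src (e : Z.row.Edge x y) : Z.bi (δ 1) (𝟙 _) e.edge = x :=
  (row_map (δ 1) e.edge).symm.trans e.src_eq

lemma row_tgt (e : Z.row.Edge x y) : Z.bi (δ 0) (𝟙 _) e.edge = y :=
  (row_map (δ 0) e.edge).symm.trans e.tgt_eq

lemma col_src (e : Z.col.Edge x y) : Z.bi (𝟙 _) (δ 1) e.edge = x :=
  (col_map (δ 1) e.edge).symm.trans e.src_eq

lemma col_tgt (e : Z.col.Edge x y) : Z.bi (𝟙 _) (δ 0) e.edge = y :=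
  (col_map (δ 0) e.edge).symm.trans e.tgt_eq

lemma δ_one_σ : δ (1 : Fin 2) ≫ σ (0 : Fin 1) = 𝟙 _ := δ_comp_σ_succ (i := (0 : Fin 1))

lemma δ_zero_σ : δ (0 : Fin 2) ≫ σ (0 : Fin 1) = 𝟙 _ := δ_comp_σ_self (i := (0 : Fin 1))

lemma rowSquare_top (e : Z.row.Edge x y) : e.edge = Z.bi (𝟙 _) (δ 1) (rowSquare e) := by
  rw [bi_bi, δ_one_σ, Category.id_comp, bi_id]

lemma rowSquare_bot (e : Z.row.Edge x y) : e.edge = Z.bi (𝟙 _) (δ 0) (rowSquare e) := by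
  rw [bi_bi, δ_zero_σ, Category.id_comp, bi_id]

lemma rowSquare_left (e : Z.row.Edge x y) :
    (SSet.Edge.id (X := Z.col) x).edge = Z.bi (δ 1) (𝟙 _) (rowSquare e) := by
  have h := congr_arg (Z.bi (𝟙 _) (σ 0)) (row_src e)
  rw [bi_bi] at h
  rw [id_col_edge, bi_bi]
  simpa using h.symm

lemma rowSquare_right (e : Z.row.Edge x y) :
    (SSet.Edge.id (X := Z.col) y).edge = Z.bi (δ 0) (𝟙 _) (rowSquare e) := by
  have h := congr_arg (Z.bi (𝟙 _) (σ 0)) (row_tgt e)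
  rw [bi_bi] at h
  rw [id_col_edge, bi_bi]
  simpa using h.symm

lemma colSquare_top (e : Z.col.Edge x y) :
    (SSet.Edge.id (X := Z.row) x).edge = Z.bi (𝟙 _) (δ 1) (colSquare e) := by
  have h := congr_arg (Z.bi (σ 0) (𝟙 _)) (col_src e)
  rw [bi_bi] at h
  rw [id_row_edge, bi_bi]
  simpa using h.symm

lemma colSquare_bot (e : Z.col.Edge x y) :
    (SSet.Edge.id (X := Z.row) y).edge = Z.bi (𝟙 _) (δ 0) (colSquare e) := by
  have h := congr_arg (Z.bi (σ 0) (𝟙 _)) (col_tgt e)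
  rw [bi_bi] at h
  rw [id_row_edge, bi_bi]
  simpa using h.symm

lemma colSquare_left (e : Z.col.Edge x y) : e.edge = Z.bi (δ 1) (𝟙 _) (colSquare e) := by
  rw [bi_bi, δ_one_σ, Category.id_comp, bi_id]

lemma colSquare_right (e : Z.col.Edge x y) : e.edge = Z.bi (δ 0) (𝟙 _) (colSquare e) := by
  rw [bi_bi, δ_zero_σ, Category.id_comp, bi_id]

end

namespace GridFunctor

open classifyingDiagram

variable {C : Cat.{u, u}} {D : Type u} [Category.{u} D]

section

variable (E : GridFunctor (classifyingDiagram.obj C ⊗ X) D)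

/-- The functor `C ⥤ D` associated to a vertex. -/
def curryObj (x : X.S ⦋0⦌ ⦋0⦌) : C ⥤ D where
  obj c := E.obj (objVertex c, x)
  map f := E.hor (rowTensor (homEdge f) (rowId x))
  map_id c := by
    rw [homEdge_id]
    exact E.hor_id _
  map_comp f g := by
    obtain ⟨h⟩ := nonempty_homEdge_comp f g
    exact (E.hor_comp (rowTensorComp h (SSet.Edge.CompStruct.idCompId (X := X.row) x))).symm

/-- The diagonal of the product of two edges factors through either corner. This factorization and
`hor_comp_right` together give the naturality of the transformation attached to `e`. -/
lemma hor_comp_left {c d : C} (f : c ⟶ d) {x y : X.S ⦋0⦌ ⦋0⦌} (e : X.row.Edge x y) :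
    (E.curryObj x).map f ≫ E.hor (rowTensor (rowId (objVertex d)) e) =
      E.hor (rowTensor (homEdge f) e) :=
  E.hor_comp (rowTensorComp (SSet.Edge.CompStruct.compId (homEdge f))
    (SSet.Edge.CompStruct.idComp e))

lemma hor_comp_right {c d : C} (f : c ⟶ d) {x y : X.S ⦋0⦌ ⦋0⦌} (e : X.row.Edge x y) :
    E.hor (rowTensor (rowId (objVertex c)) e) ≫ (E.curryObj y).map f =
      E.hor (rowTensor (homEdge f) e) :=
  E.hor_comp (rowTensorComp (SSet.Edge.CompStruct.idComp (homEdge f))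
    (SSet.Edge.CompStruct.compId e))

/-- A grid functor on a product with a classifying diagram can be curried. -/
def curry : GridFunctor X (C ⥤ D) where
  obj x := E.curryObj x
  hor e := { app := fun c => E.hor (rowTensor (rowId (objVertex c)) e)
             naturality := fun c d f => (E.hor_comp_left f e).trans (E.hor_comp_right f e).symm }
  -- Naturality comes from the product of two degenerate squares, one constant vertically on `f` and
  -- one constant horizontally on `e`.
  ver e := NatIso.ofComponents (fun c => E.ver (colTensor (colId (objVertex c)) e))
    (fun f => E.square (rowSquare (homEdge f), colSquare e)
      (Prod.ext (rowSquare_top _) (colSquare_top _)) (Prod.ext (rowSquare_bot _) (colSquare_bot _))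
      (Prod.ext (rowSquare_left _) (colSquare_left _))
      (Prod.ext (rowSquare_right _) (colSquare_right _)))
  hor_id x := by
    ext c
    exact E.hor_id _
  ver_id x := by
    ext c
    exact E.ver_id _
  hor_comp h := by
    ext c
    exact E.hor_comp (rowTensorComp
      (SSet.Edge.CompStruct.idCompId (X := (classifyingDiagram.obj C).row) (objVertex c)) h)
  ver_comp h := by
    ext c
    exact E.ver_comp (colTensorComp (SSet.Edge.CompStruct.idCompId (objVertex c)) h)
  square s ht hb hl hr := by
    ext c
    exact E.square (rowSquare (rowId (objVertex c)), s)
      (Prod.ext (rowSquare_top _) ht) (Prod.ext (rowSquare_bot _) hb)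
      (Prod.ext (rowSquare_left _) hl) (Prod.ext (rowSquare_right _) hr)

end

end GridFunctor

end SimplicialSpace

/-! ### The universal property of the evaluation. -/

namespace classifyingDiagram

open SimplexCategory SimplicialSpace

variable {C D : Cat.{u, u}} {X : SimplicialSpace.{u}}

variable (C D) in
/-- The evaluation `N C × N (D ^ C) ⟶ N D`. -/
def ev : classifyingDiagram.obj C ⊗ classifyingDiagram.obj (Cat.of (C ⥤ D)) ⟶
    classifyingDiagram.obj D :=
  (prodIso C (Cat.of (C ⥤ D))).inv ≫ classifyingDiagram.map (evaluationUncurried C D).toCatHom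

lemma horArrow_ev {m n : SimplexCategory} (s : (classifyingDiagram.obj C).S m n)
    (t : (classifyingDiagram.obj (Cat.of (C ⥤ D))).S m n) {i i' : Fin (m.len + 1)} (h : i ≤ i')
    (j : Fin (n.len + 1)) :
    horArrow (((ev C D).app _).app _ (s, t)) h j =
      Arrow.mk (((t.obj j).of.obj i).map ((s.obj j).of.map (homOfLE h)) ≫
        NatTrans.app ((t.obj j).of.map (homOfLE h)) ((s.obj j).of.obj i')) := rfl

lemma verArrow_ev {m n : SimplexCategory} (s : (classifyingDiagram.obj C).S m n)
    (t : (classifyingDiagram.obj (Cat.of (C ⥤ D))).S m n) (i : Fin (m.len + 1))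
    {j j' : Fin (n.len + 1)} (h : j ≤ j') :
    verArrow (((ev C D).app _).app _ (s, t)) i h =
      Arrow.mk (((t.obj j).of.obj i).map ((s.map (homOfLE h)).iso.hom.app i) ≫
        NatTrans.app ((t.map (homOfLE h)).iso.hom.app i) ((s.obj j').of.obj i)) := rfl

lemma nerveToRow_obj (s : (classifyingDiagram.obj C).S ⦋0⦌ ⦋0⦌) :
    objVertex ((s.obj (0 : Fin 1)).of.obj (0 : Fin 1)) = s :=
  (congr_arg ((nerveToRow C).app _) (ComposableArrows.ext₀
    (F := ComposableArrows.mk₀ _) (G := (s.obj (0 : Fin 1)).of) rfl)).trans (nerveToRow_rowToNerve s)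

/-- A vertical edge of a classifying diagram, with explicit endpoints. -/
def isoEdge (a : (classifyingDiagram.obj C).S ⦋0⦌ ⦋1⦌) :
    (classifyingDiagram.obj C).col.Edge (objVertex ((a.obj (0 : Fin 2)).of.obj (0 : Fin 1)))
      (objVertex ((a.obj (1 : Fin 2)).of.obj (0 : Fin 1))) :=
  SSet.Edge.mk a ((nerveToRow_obj _).symm) ((nerveToRow_obj _).symm)

/-- The product of `isoSquare` with the degenerate square on `e` has left side `(a, e)` and a bottom
sent to an identity. Its commutativity expresses the value on `(a, e)` through the curried data. -/
lemma _root_.SimplicialSpace.GridFunctor.hor_comp_ver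
    (E : GridFunctor (classifyingDiagram.obj C ⊗ X) D)
    (a : (classifyingDiagram.obj C).S ⦋0⦌ ⦋1⦌) {x y : X.S ⦋0⦌ ⦋0⦌} (e : X.col.Edge x y) :
    (E.curryObj x).map ((a.map (homOfLE (Fin.zero_le (1 : Fin 2)))).iso.hom.app (0 : Fin 1)) ≫
      (E.ver (colTensor (colId (objVertex ((a.obj (1 : Fin 2)).of.obj (0 : Fin 1)))) e)).hom =
    (E.ver (colTensor (isoEdge a) e)).hom := by
  let i := (a.map (homOfLE (Fin.zero_le (1 : Fin 2)))).iso.app (0 : Fin 1)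
  have h := E.square (t := rowTensor (homEdge i.hom) (rowId x))
    (b := rowTensor (homEdge (𝟙 _)) (rowId y)) (r := colTensor (colId (objVertex _)) e)
    (l := colTensor (isoEdge a) e) (isoSquare i, colSquare e)
    (Prod.ext (isoSquare_top i).symm (colSquare_top e))
    (Prod.ext (isoSquare_bot i).symm (colSquare_bot e))
    (Prod.ext (isoSquare_left a).symm (colSquare_left e))
    (Prod.ext (isoSquare_right i).symm (colSquare_right e))
  have h' : E.hor (rowTensor (homEdge (𝟙 ((a.obj (1 : Fin 2)).of.obj (0 : Fin 1)))) (rowId y)) =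
      𝟙 _ := (E.curryObj y).map_id _
  rw [h'] at h
  exact h.trans (Category.comp_id _)

/-- Every map `N C × X ⟶ N D` factors through the evaluation. -/
lemma exists_curry (φ : classifyingDiagram.obj C ⊗ X ⟶ classifyingDiagram.obj D) :
    ∃ ψ : X ⟶ classifyingDiagram.obj (Cat.of (C ⥤ D)), classifyingDiagram.obj C ◁ ψ ≫ ev C D = φ := by
  let E := toGridFunctor φ
  -- By `hom_ext` only edges matter. There `ev` composes a value of a functor with a component of a
  -- transformation, and `hor_comp_left` and `hor_comp_ver` identify the composite with the value of
  -- `E` on the product edge.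
  refine ⟨GridFunctor.toHom (D := Cat.of (C ⥤ D)) E.curry, hom_ext ?_ ?_⟩
  · rintro ⟨a, x⟩
    refine (horArrow_ev a _ (Fin.zero_le 1) 0).trans ?_
    have h := E.hor_comp_left ((a.obj (0 : Fin 1)).of.map (homOfLE (Fin.zero_le (1 : Fin 2))))
      (rowEdge x (Fin.zero_le 1) 0)
    refine (congr_arg Arrow.mk h).trans ((arrow_toGridFunctor_hor φ _).trans ?_)
    congr 2
    refine Prod.ext (homEdge_edge a) ?_
    change X.bi (edgeMap ⦋1⦌ (Fin.zero_le 1)) (vertexMap ⦋0⦌ 0) _ = _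
    rw [edgeMap_zero_one, vertexMap_zero, bi_id]
  · rintro ⟨a, x⟩
    refine (verArrow_ev a _ 0 (Fin.zero_le 1)).trans ?_
    have h := E.hor_comp_ver a (colEdge x 0 (Fin.zero_le 1))
    refine (congr_arg Arrow.mk h).trans ((arrow_toGridFunctor_ver φ _).trans ?_)
    congr 2
    refine Prod.ext rfl ?_
    change X.bi (vertexMap ⦋0⦌ 0) (edgeMap ⦋1⦌ (Fin.zero_le 1)) _ = _
    rw [edgeMap_zero_one, vertexMap_zero, bi_id]

lemma arrow_functor_ext {C D : Type*} [Category* C] [Category* D] {F G F' G' : C ⥤ D}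
    (hF : F = F') (hG : G = G') (f : F ⟶ G) (f' : F' ⟶ G')
    (h : ∀ i, Arrow.mk (f.app i) = Arrow.mk (f'.app i)) : Arrow.mk f = Arrow.mk f' := by
  subst hF hG
  congr 1
  ext i
  exact Arrow.mk_injective _ _ (h i)

lemma horArrow_ev_degenerate {c d : C} (f : c ⟶ d)
    (t : (classifyingDiagram.obj (Cat.of (C ⥤ D))).S ⦋0⦌ ⦋0⦌) :
    horArrow (((ev C D).app _).app _ ((homEdge f).edge,
      (classifyingDiagram.obj (Cat.of (C ⥤ D))).bi (σ 0) (𝟙 _) t)) (Fin.zero_le 1) 0 =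
      Arrow.mk (((t.obj (0 : Fin 1)).of.obj (0 : Fin 1)).map f) := by
  refine congr_arg Arrow.mk (Eq.trans ?_ (Category.comp_id _))
  refine congr_arg (((t.obj (0 : Fin 1)).of.obj (0 : Fin 1)).map f ≫ ·) ?_
  exact congr_arg (fun τ => NatTrans.app τ d) ((t.obj (0 : Fin 1)).of.map_id (0 : Fin 1))

lemma horArrow_ev_id (c : C) (t : (classifyingDiagram.obj (Cat.of (C ⥤ D))).S ⦋1⦌ ⦋0⦌) :
    horArrow (((ev C D).app _).app _ ((homEdge (𝟙 c)).edge, t)) (Fin.zero_le 1) 0 =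
      Arrow.mk (NatTrans.app ((t.obj (0 : Fin 1)).of.map
        (homOfLE (Fin.zero_le (1 : Fin 2)))) c) := by
  refine congr_arg Arrow.mk (Eq.trans ?_ (Category.id_comp _))
  refine congr_arg (· ≫ NatTrans.app ((t.obj (0 : Fin 1)).of.map
    (homOfLE (Fin.zero_le (1 : Fin 2)))) c) ?_
  exact ((t.obj (0 : Fin 1)).of.obj (0 : Fin 2)).map_id c

lemma verArrow_ev_id (c : C) (t : (classifyingDiagram.obj (Cat.of (C ⥤ D))).S ⦋0⦌ ⦋1⦌) :
    verArrow (((ev C D).app _).app _ ((colId (objVertex c)).edge, t)) 0 (Fin.zero_le 1) =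
      Arrow.mk (NatTrans.app ((t.map (homOfLE (Fin.zero_le (1 : Fin 2)))).iso.hom.app
        (0 : Fin 1)) c) := by
  refine congr_arg Arrow.mk (Eq.trans ?_ (Category.id_comp _))
  refine congr_arg (· ≫ NatTrans.app ((t.map (homOfLE (Fin.zero_le (1 : Fin 2)))).iso.hom.app
        (0 : Fin 1)) c) ?_
  exact ((t.obj (0 : Fin 2)).of.obj (0 : Fin 1)).map_id c

/-- Evaluating at a degenerate second coordinate recovers the functors at the vertices of `X`;
evaluating at identities of `C` recovers the components of the transformations on its edges. -/
lemma curry_injective {ψ ψ' : X ⟶ classifyingDiagram.obj (Cat.of (C ⥤ D))}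
    (h : classifyingDiagram.obj C ◁ ψ ≫ ev C D = classifyingDiagram.obj C ◁ ψ' ≫ ev C D) :
    ψ = ψ' := by
  have key {m n : SimplexCategory} (a : (classifyingDiagram.obj C).S m n) (x : X.S m n) :
      ((ev C D).app _).app _ (a, (ψ.app _).app _ x) =
        ((ev C D).app _).app _ (a, (ψ'.app _).app _ x) :=
    congr_arg (fun t : classifyingDiagram.obj C ⊗ X ⟶ classifyingDiagram.obj D =>
      (t.app (op m)).app (op n) (a, x)) h
  have hob (y : X.S ⦋0⦌ ⦋0⦌) : (((ψ.app _).app _ y).obj (0 : Fin 1)).of.obj (0 : Fin 1) =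
      (((ψ'.app _).app _ y).obj (0 : Fin 1)).of.obj (0 : Fin 1) := by
    refine Arrow.functor_ext fun c d f => ?_
    refine (horArrow_ev_degenerate f _).symm.trans (Eq.trans ?_ (horArrow_ev_degenerate f _))
    rw [bi_app, bi_app, key]
  refine hom_ext (fun x => ?_) (fun x => ?_)
  · refine arrow_functor_ext ?_ ?_ _ _ (fun c => ?_)
    · have := hob (X.bi (vertexMap ⦋1⦌ 0) (𝟙 _) x)
      rw [← bi_app, ← bi_app] at this
      exact this
    · have := hob (X.bi (vertexMap ⦋1⦌ 1) (𝟙 _) x)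
      rw [← bi_app, ← bi_app] at this
      exact this
    · refine (horArrow_ev_id c _).symm.trans (Eq.trans ?_ (horArrow_ev_id c _))
      rw [key]
  · refine arrow_functor_ext ?_ ?_ _ _ (fun c => ?_)
    · have := hob (X.bi (𝟙 _) (vertexMap ⦋1⦌ 0) x)
      rw [← bi_app, ← bi_app] at this
      exact this
    · have := hob (X.bi (𝟙 _) (vertexMap ⦋1⦌ 1) x)
      rw [← bi_app, ← bi_app] at this
      exact this
    · refine (verArrow_ev_id c _).symm.trans (Eq.trans ?_ (verArrow_ev_id c _))
      rw [key]

end classifyingDiagram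

/-! ### Full faithfulness and the exponential isomorphism. -/

namespace classifyingDiagram

open SimplexCategory SimplicialSpace

variable {C D : Cat.{u, u}} {X : SimplicialSpace.{u}}

lemma verArrow_ev_degenerate (a : (classifyingDiagram.obj C).S ⦋0⦌ ⦋1⦌)
    (t : (classifyingDiagram.obj (Cat.of (C ⥤ D))).S ⦋0⦌ ⦋0⦌) :
    verArrow (((ev C D).app _).app _ (a,
      (classifyingDiagram.obj (Cat.of (C ⥤ D))).bi (𝟙 _) (σ 0) t)) 0 (Fin.zero_le 1) =
      Arrow.mk (((t.obj (0 : Fin 1)).of.obj (0 : Fin 1)).map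
        ((a.map (homOfLE (Fin.zero_le (1 : Fin 2)))).iso.hom.app (0 : Fin 1))) := by
  refine congr_arg Arrow.mk (Eq.trans ?_ (Category.comp_id _))
  refine congr_arg (((t.obj (0 : Fin 1)).of.obj (0 : Fin 1)).map
    ((a.map (homOfLE (Fin.zero_le (1 : Fin 2)))).iso.hom.app (0 : Fin 1)) ≫ ·) ?_
  exact congr_arg (fun τ => NatTrans.app τ _) (core_map_id_app t (0 : Fin 1) (0 : Fin 1))

instance : classifyingDiagram.{u}.Faithful where
  map_injective {C D} F G h := by
    apply Cat.Hom.ext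
    refine Arrow.functor_ext fun c d f => ?_
    exact congr_arg (fun t : classifyingDiagram.obj C ⟶ classifyingDiagram.obj D =>
      horArrow ((t.app _).app _ (homEdge f).edge) (Fin.zero_le 1) 0) h

/-- Regarded as a map out of `N C ⊗ 𝟙_`, `φ` factors through `ev` by a vertex of `N (C ⥤ D)`, which
is a functor `F`. Evaluating at degeneracies of this vertex shows that `N F` and `φ` agree on edges.
-/
instance : classifyingDiagram.{u}.Full where
  map_surjective {C D} φ := by
    obtain ⟨ψ, hψ⟩ := exists_curry (X := 𝟙_ SimplicialSpace.{u}) (fst _ _ ≫ φ)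
    let x : (𝟙_ SimplicialSpace.{u}).S ⦋0⦌ ⦋0⦌ := PUnit.unit
    have key {m n : SimplexCategory} (a : (classifyingDiagram.obj C).S m n)
        (x : (𝟙_ SimplicialSpace.{u}).S m n) :
        ((ev C D).app _).app _ (a, (ψ.app _).app _ x) = (φ.app _).app _ a :=
      congr_arg (fun t : classifyingDiagram.obj C ⊗ 𝟙_ SimplicialSpace.{u} ⟶
        classifyingDiagram.obj D => (t.app (op m)).app (op n) (a, x)) hψ
    let F : C ⥤ D := (((ψ.app _).app _ x).obj (0 : Fin 1)).of.obj (0 : Fin 1)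
    refine ⟨F.toCatHom, hom_ext (fun a => ?_) (fun a => ?_)⟩
    · refine (horArrow_ev_degenerate ((a.obj (0 : Fin 1)).of.map
        (homOfLE (Fin.zero_le (1 : Fin 2)))) ((ψ.app _).app _ x)).symm.trans ?_
      rw [bi_app, key, homEdge_edge]
    · refine (verArrow_ev_degenerate a ((ψ.app _).app _ x)).symm.trans ?_
      rw [bi_app, key]

/-- The isomorphism `N (D ^ C) ≅ (N D) ^ (N C)`. -/
noncomputable def ihomIso (C D : Cat.{u, u}) : classifyingDiagram.obj (Cat.of (C ⥤ D)) ≅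
    (ihom (classifyingDiagram.obj C)).obj (classifyingDiagram.obj D) where
  hom := MonoidalClosed.curry (ev C D)
  -- The inverse is the factorization through `ev` of the evaluation map of the internal hom.
  inv := (exists_curry (MonoidalClosed.uncurry (𝟙 _))).choose
  hom_inv_id := by
    apply curry_injective
    rw [MonoidalCategory.whiskerLeft_comp, Category.assoc, (exists_curry _).choose_spec,
      ← MonoidalClosed.uncurry_natural_left, Category.comp_id, MonoidalClosed.uncurry_curry,
      MonoidalCategory.whiskerLeft_id, Category.id_comp]
  inv_hom_id := by
    rw [← MonoidalClosed.curry_natural_left, (exists_curry _).choose_spec,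
      MonoidalClosed.curry_uncurry]

/-- On edges the equation says that `G` preserves the composite by which evaluation is defined. -/
lemma whiskerLeft_map_ev {C D D' : Cat.{u, u}} (G : D ⟶ D') :
    classifyingDiagram.obj C ◁
      classifyingDiagram.map ((Functor.whiskeringRight C D D').obj G.toFunctor).toCatHom ≫
        ev C D' = ev C D ≫ classifyingDiagram.map G :=
  hom_ext (fun _ => congr_arg Arrow.mk (G.toFunctor.map_comp _ _).symm)
    (fun _ => congr_arg Arrow.mk (G.toFunctor.map_comp _ _).symm)

lemma whiskerRight_map_ev {C C' D : Cat.{u, u}} (F : C' ⟶ C) :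
    classifyingDiagram.obj C' ◁
      classifyingDiagram.map ((Functor.whiskeringLeft C' C D).obj F.toFunctor).toCatHom ≫
        ev C' D = classifyingDiagram.map F ▷ _ ≫ ev C D :=
  rfl

end classifyingDiagram

end

theorem mainTheorem6 :
    -- the natural isomorphism `N (C × D) ≅ N C × N D`, given by the two projections
    (∃ α : ∀ C D : Cat.{u, u}, classifyingDiagram.obj (Cat.of (C × D)) ≅
          classifyingDiagram.obj C ⊗ classifyingDiagram.obj D,
      (∀ (C D : Cat.{u, u}),
        (α C D).hom ≫ fst _ _ = classifyingDiagram.map (CategoryTheory.Prod.fst C D).toCatHom ∧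
        (α C D).hom ≫ snd _ _ = classifyingDiagram.map (CategoryTheory.Prod.snd C D).toCatHom) ∧
      (∀ (C C' D D' : Cat.{u, u}) (F : C ⟶ C') (G : D ⟶ D'),
        classifyingDiagram.map (F.toFunctor.prod G.toFunctor).toCatHom ≫ (α C' D').hom =
          (α C D).hom ≫ (classifyingDiagram.map F ⊗ₘ classifyingDiagram.map G)) ∧
      -- the natural isomorphism `N (D ^ C) ≅ (N D) ^ (N C)`, adjoint to the evaluation
      ∃ β : ∀ C D : Cat.{u, u}, classifyingDiagram.obj (Cat.of (C ⥤ D)) ≅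
          (ihom (classifyingDiagram.obj C)).obj (classifyingDiagram.obj D),
        (∀ (C D : Cat.{u, u}),
          (α C (Cat.of (C ⥤ D))).hom ≫ MonoidalClosed.uncurry (β C D).hom =
            classifyingDiagram.map (evaluationUncurried C D).toCatHom) ∧
        (∀ (C D D' : Cat.{u, u}) (G : D ⟶ D'),
          classifyingDiagram.map ((Functor.whiskeringRight C D D').obj G.toFunctor).toCatHom ≫
              (β C D').hom =
            (β C D).hom ≫ (ihom (classifyingDiagram.obj C)).map (classifyingDiagram.map G)) ∧
        (∀ (C C' D : Cat.{u, u}) (F : C' ⟶ C),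
          classifyingDiagram.map ((Functor.whiskeringLeft C' C D).obj F.toFunctor).toCatHom ≫
              (β C' D).hom =
            (β C D).hom ≫ (MonoidalClosed.pre (classifyingDiagram.map F)).app
              (classifyingDiagram.obj D))) ∧
    -- `N` is a full embedding
    (classifyingDiagram.{u}.Full ∧ classifyingDiagram.{u}.Faithful) ∧
    -- `f` is an equivalence of categories if and only if `N f` is a weak equivalence
    (∀ (C D : Cat.{u, u}) (f : C ⟶ D),
      f.toFunctor.IsEquivalence ↔
        SimplicialSpace.IsWeakEquivalence (classifyingDiagram.map f)) := by

  refine ⟨⟨classifyingDiagram.prodIso, fun C D => ⟨lift_fst _ _, lift_snd _ _⟩, fun C C' D D' F G => rfl,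
    classifyingDiagram.ihomIso,
    fun C D => ?_, fun C D D' G => ?_, fun C C' D F => ?_⟩, ⟨inferInstance, inferInstance⟩,
    fun C D f => classifyingDiagram.isEquivalence_iff f⟩
  · rw [classifyingDiagram.ihomIso, MonoidalClosed.uncurry_curry, classifyingDiagram.ev, Iso.hom_inv_id_assoc]
    rfl
  -- After uncurrying, naturality becomes an identity between maps built from `ev`.
  · apply MonoidalClosed.uncurry_injective
    rw [MonoidalClosed.uncurry_natural_left, MonoidalClosed.uncurry_natural_right]
    dsimp only [classifyingDiagram.ihomIso]
    rw [MonoidalClosed.uncurry_curry, MonoidalClosed.uncurry_curry]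
    exact classifyingDiagram.whiskerLeft_map_ev G
  · apply MonoidalClosed.uncurry_injective
    rw [MonoidalClosed.uncurry_natural_left]
    dsimp only [classifyingDiagram.ihomIso]
    rw [MonoidalClosed.curry_pre_app, MonoidalClosed.uncurry_curry, MonoidalClosed.uncurry_curry]
    exact classifyingDiagram.whiskerRight_map_ev F
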